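/- Let $n\ge 2$ and $\overline{\mathbb R}^n=\mathbb R^n\cup\{\infty\}$. A bounded domain $D\subset\mathbb R^n$ with $0\in D$ is *strictly starlike* (w.r.t. the origin) if every ray from $0$ meets $\mathcal M=\partial D$ at exactly one point. For $x\ne 0$ let $r_x=|w|$, where $w$ is the point of $\mathcal M$ on the ray $\{tx:t>0\}$. The *quasi-inversion* in $\mathcal M$ is $f_{\mathcal M}(x)=\frac{r_x^2}{|x|^2}x$ for $x\in\mathbb R^n\setminus\{0\}$, $f_{\mathcal M}(0)=\infty$, $f_{\mathcal M}(\infty)=0$. For $x\in\mathcal M$ let $\alpha(x)=\liminf_{z\to x,\,z\in\mathcal M\setminus\{x\}}\alpha(z,x)\in[0,\pi/2]$, where $\alpha(z,x)$ is the acute angle which the segment $[z,x]$ makes with the ray from $0$ through $x$. The domain $D$ satisfies the *$\alpha$-tangent condition*, where $\alpha\in(0,\pi/2]$, if $\alpha(x)\ge\alpha$ for all $x\in\mathcal M$. Put $$L(\mathcal M,\alpha)=\max\Big\{\tfrac12\max_{x\in\mathcal M}|x|,\ \tfrac{1}{2\min_{x\in\mathcal M}|x|}\Big\}\Big(\sqrt{\csc^2\alpha-1}+\sqrt{\csc^2\alpha+3}\Big).$$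 For a domain $G\subset\overline{\mathbb R}^n$ whose boundary in $\overline{\mathbb R}^n$ has at least two points, the *Möbius (absolute ratio) metric* is $$\delta_G(x,y)=\log\Big(1+\sup_{a,b\in\partial G}\frac{|a-b||x-y|}{|a-x||b-y|}\Big),$$ and *Ferrand's metric* is $\sigma_G(x,y)=\inf_\gamma\int_\gamma w_G(t)\,|dt|$ with $w_G(x)=\sup_{a,b\in\partial G}\frac{|a-b|}{|x-a||x-b|}$, the infimum being over all rectifiable curves $\gamma$ joining $x$ and $y$ in $G$. Boundaries are taken in $\overline{\mathbb R}^n$, and factors with an infinite entry are cancelled in the usual way; if $\infty\in G$, curves may pass through $\infty$, rectifiability refers to the chordal metric, and the integral is taken over the part of $\gamma$ in $\mathbb R^n$. A map $f:(X,d_X)\to(Y,d_Y)$ is *$C$-bi-Lipschitz* if it is a homeomorphism and $d_X(x,y)/C\le d_Y(f(x),f(y))\le C\,d_X(x,y)$ for all $x,y\in X$. **Theorem.** (1) Let $D\subset\mathbb R^n$ be a strictly starlike domain which satisfies the $\alpha$-tangent condition, let $\mathcal M=\partial D$ and $L=L(\mathcal M,\alpha)$, and let $G\subsetneq\mathbb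 R^n$ be a domain. Then $f_{\mathcal M}:G\to f_{\mathcal M}G$ is an $L^8$-bi-Lipschitz map both with respect to the Möbius metrics $\delta_G$, $\delta_{f_{\mathcal M}G}$ and with respect to Ferrand's metrics $\sigma_G$, $\sigma_{f_{\mathcal M}G}$. (2) For $t\in[0,1]$ let $\mathcal M_t$ be the boundary of a strictly starlike domain $D_t\subset\mathbb R^n$ which satisfies a tangent condition for some angle in $(0,\pi/2]$, let $\alpha_t=\inf_{x\in\mathcal M_t}\alpha(x)$ be the largest such angle, and put $L_t=L(\mathcal M_t,\alpha_t)$. Let $\varphi_t(x)=r^{(t)}_x x$, $\varphi_t(0)=0$, be the radial extension which maps the unit sphere $S^{n-1}$ to $\mathcal M_t$, where $r^{(t)}_x$ is the number $r_x$ of $\mathcal M_t$. If $\mathcal M_t$ converges smoothly to the unit sphere as $t\to0$, i.e. $\lim_{t\to0}\operatorname{ess\,sup}_{|x|=1}|\varphi_t'(x)-I|=0$, then $\lim_{t\to 0}L_t=1$, and for every $t\in[0,1]$ and every domain $G\subsetneq\mathbb R^n$ the quasi-inversion $f_{\mathcal M_t}:G\to f_{\mathcal M_t}G$ is $L_t^8$-bi-Lipschitz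 with respect to both metrics. In particular, its bi-Lipschitz constants tend to $1$ as $t\to0$, uniformly in $G$. -/

import Mathlib

open Set Filter Topology MeasureTheory
open scoped ENNReal OnePoint

noncomputable section

namespace QuasiInv

/-- Euclidean `n`-space; its Möbius compactification (with the point `∞`) is `OnePoint (E n)`. -/
abbrev E (n : ℕ) : Type := EuclideanSpace ℝ (Fin n)

/-! ### Strictly starlike domains and the tangent condition -/

/-- `D` is a bounded domain containing the origin such that every ray emanating from the origin
meets the boundary of `D` at exactly one point. -/
structure IsStrictlyStarlike {n : ℕ} (D : Set (E n)) : Prop where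
  isOpen : IsOpen D
  isConnected : IsConnected D
  isBounded : Bornology.IsBounded D
  zero_mem : (0 : E n) ∈ D
  existsUnique_ray : ∀ x : E n, x ≠ 0 → ∃! w : E n, w ∈ frontier D ∧ ∃ t : ℝ, 0 < t ∧ w = t • x

/-- The acute angle between the lines spanned by `u` and `v`. -/
def acuteAngle {n : ℕ} (u v : E n) : ℝ :=
  min (InnerProductGeometry.angle u v) (Real.pi - InnerProductGeometry.angle u v)

/-- `α(x)`: the lower limit, as the boundary point `z ≠ x` tends to `x`, of the acute angle which
the segment `[z, x]` makes with the ray from `0` through `x`. -/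
def tangentAngle {n : ℕ} (D : Set (E n)) (x : E n) : ℝ :=
  liminf (fun z => acuteAngle (z - x) x) (𝓝[frontier D \ {x}] x)

/-- The `α`-tangent condition. -/
def TangentCondition {n : ℕ} (D : Set (E n)) (α : ℝ) : Prop :=
  0 < α ∧ α ≤ Real.pi / 2 ∧ ∀ x ∈ frontier D, α ≤ tangentAngle D x

/-- The largest candidate for `α` in the tangent condition: the infimum of `α(x)` over the
boundary. -/
def sharpAngle {n : ℕ} (D : Set (E n)) : ℝ :=
  ⨅ x : frontier D, tangentAngle D x

/-! ### Polar radius, radial extension, quasi-inversion -/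

/-- `r_x = |w|`, where `w` is the point (unique for strictly starlike `D` and `x ≠ 0`) of the
boundary of `D` on the ray `{t x : t > 0}`. -/
def polarRadius {n : ℕ} (D : Set (E n)) (x : E n) : ℝ :=
  sSup {ρ : ℝ | ∃ w ∈ frontier D, (∃ t : ℝ, 0 < t ∧ w = t • x) ∧ ρ = ‖w‖}

/-- The radial extension `x ↦ |x| φ(x / |x|) = r_x x`, `0 ↦ 0`, where `φ` is the inverse of the
radial projection of the boundary of `D` to the unit sphere. -/
def radialExtension {n : ℕ} (D : Set (E n)) (x : E n) : E n :=
  polarRadius D x • x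

/-- The quasi-inversion in the boundary of `D`:
`x ↦ (r_x ^ 2 / |x| ^ 2) x`, `0 ↦ ∞`, `∞ ↦ 0`. -/
def quasiInversion {n : ℕ} (D : Set (E n)) : OnePoint (E n) → OnePoint (E n)
  | ∞ => ((0 : E n) : OnePoint (E n))
  | OnePoint.some x =>
      open Classical in
      if x = 0 then ∞ else (((polarRadius D x ^ 2 / ‖x‖ ^ 2) • x : E n) : OnePoint (E n))

/-- The constant `L = max {L₁, L₂}`, with
`L₁ = (max |x| / 2) (√(csc² α - 1) + √(csc² α + 3))` and
`L₂ = (1 / (2 min |x|)) (√(csc² α - 1) + √(csc² α + 3))`, the extrema being taken over the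
boundary of `D`. -/
def lipConst {n : ℕ} (D : Set (E n)) (α : ℝ) : ℝ :=
  max
    (sSup (norm '' frontier D) / 2 *
      (√((1 / Real.sin α) ^ 2 - 1) + √((1 / Real.sin α) ^ 2 + 3)))
    (1 / (2 * sInf (norm '' frontier D)) *
      (√((1 / Real.sin α) ^ 2 - 1) + √((1 / Real.sin α) ^ 2 + 3)))

/-- The boundaries of the domains `D t` converge smoothly to the sphere `S^{n-1}(r)` as `t → 0`:
`ess sup_{|x| = 1} |φ_t'(x) - r I| → 0` for the radial extensions `φ_t`, the essential supremum
being with respect to the surface measure of the unit sphere. -/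
def SmoothlyConvergesToSphere {n : ℕ} (D : ℝ → Set (E n)) (r : ℝ) : Prop :=
  Tendsto
    (fun t : ℝ => essSup
      (fun x : Metric.sphere (0 : E n) 1 =>
        ‖fderiv ℝ (radialExtension (D t)) (x : E n) - r • ContinuousLinearMap.id ℝ (E n)‖ₑ)
      (volume : Measure (E n)).toSphere)
    (𝓝[>] 0) (𝓝 0)

/-! ### The Möbius metric and Ferrand's metric -/

/-- The factor `|x - y|` occurring in absolute ratios. A factor with exactly one infinite entry is
counted as `1`, which is the usual convention that such factors cancel. -/
def gap {n : ℕ} : OnePoint (E n) → OnePoint (E n) → ℝ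
  | ∞, ∞ => 0
  | ∞, OnePoint.some _ => 1
  | OnePoint.some _, ∞ => 1
  | OnePoint.some x, OnePoint.some y => ‖x - y‖

/-- The absolute (cross) ratio `|a, b, c, d| = |a - c| |b - d| / (|a - b| |c - d|)`. -/
def absRatio {n : ℕ} (a b c d : OnePoint (E n)) : ℝ :=
  gap a c * gap b d / (gap a b * gap c d)

/-- Seittenranta's Möbius (absolute ratio) metric
`δ_G(x, y) = log (1 + sup_{a, b ∈ ∂G} |a, x, b, y|)`; the boundary is taken in the
compactified space. -/
def mobiusDist {n : ℕ} (G : Set (OnePoint (E n))) (x y : OnePoint (E n)) : ℝ≥0∞ :=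
  (ENNReal.log
    (1 + ⨆ a ∈ frontier G, ⨆ b ∈ frontier G, ENNReal.ofReal (absRatio a x b y))).toENNReal

/-- Ferrand's density `w_G(x) = sup_{a, b ∈ ∂G} |a - b| / (|x - a| |x - b|)` at a finite point. -/
def ferrandDensity {n : ℕ} (G : Set (OnePoint (E n))) (x : E n) : ℝ≥0∞ :=
  ⨆ a ∈ frontier G, ⨆ b ∈ frontier G,
    ENNReal.ofReal (gap a b / (gap (x : OnePoint (E n)) a * gap (x : OnePoint (E n)) b))

/-- The chordal metric. -/
def chordal {n : ℕ} : OnePoint (E n) → OnePoint (E n) → ℝ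
  | ∞, ∞ => 0
  | ∞, OnePoint.some y => 1 / √(1 + ‖y‖ ^ 2)
  | OnePoint.some x, ∞ => 1 / √(1 + ‖x‖ ^ 2)
  | OnePoint.some x, OnePoint.some y => ‖x - y‖ / (√(1 + ‖x‖ ^ 2) * √(1 + ‖y‖ ^ 2))

/-- The underlying vector of a finite point (and `0` for `∞`). -/
def finitePart {n : ℕ} : OnePoint (E n) → E n
  | ∞ => 0
  | OnePoint.some x => x

/-- `γ` (restricted to `[0, 1]`) is a rectifiable curve in `G` joining `x` and `y`, given in a
Lipschitz parametrization, e.g. proportional to arc length. As `G` may contain `∞`, the length is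
measured in the chordal metric; for a curve avoiding `∞` (its trace is then a compact subset of
Euclidean space) this is the same as being Lipschitz in the Euclidean metric. -/
structure IsRectifiableCurve {n : ℕ} (G : Set (OnePoint (E n))) (x y : OnePoint (E n))
    (γ : ℝ → OnePoint (E n)) : Prop where
  lipschitz : ∃ K : ℝ, ∀ s ∈ Icc (0 : ℝ) 1, ∀ t ∈ Icc (0 : ℝ) 1,
    chordal (γ s) (γ t) ≤ K * |s - t|
  mem : ∀ t ∈ Icc (0 : ℝ) 1, γ t ∈ G
  source : γ 0 = x
  target : γ 1 = y

/-- The line integral `∫_γ w |dx|` of a density `w` given at finite points. -/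
def lineIntegral {n : ℕ} (w : E n → ℝ≥0∞) (γ : ℝ → OnePoint (E n)) : ℝ≥0∞ :=
  ∫⁻ t in {t : ℝ | t ∈ Icc (0 : ℝ) 1 ∧ γ t ≠ OnePoint.infty},
    w (finitePart (γ t)) * ‖deriv (fun s => finitePart (γ s)) t‖ₑ

/-- Ferrand's metric `σ_G(x, y) = inf_γ ∫_γ w_G |dx|`, the infimum being over all rectifiable
curves `γ` joining `x` and `y` in `G`. -/
def ferrandDist {n : ℕ} (G : Set (OnePoint (E n))) (x y : OnePoint (E n)) : ℝ≥0∞ :=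
  ⨅ (γ : ℝ → OnePoint (E n)) (_ : IsRectifiableCurve G x y γ), lineIntegral (ferrandDensity G) γ

/-! ### Bi-Lipschitz maps -/

/-- `f`, restricted to `G`, is a `C`-bi-Lipschitz homeomorphism of `(G, d)` onto `(f G, d')`. -/
structure IsBiLipschitzOn {X : Type*} [TopologicalSpace X] (C : ℝ) (d d' : X → X → ℝ≥0∞)
    (f : X → X) (G : Set X) : Prop where
  isEmbedding : IsEmbedding (G.domRestrict f)
  lower : ∀ x ∈ G, ∀ y ∈ G, d x y / ENNReal.ofReal C ≤ d' (f x) (f y)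
  upper : ∀ x ∈ G, ∀ y ∈ G, d' (f x) (f y) ≤ ENNReal.ofReal C * d x y

/-- The subset `G` of Euclidean space, seen in the compactified space. -/
def toExt {n : ℕ} (G : Set (E n)) : Set (OnePoint (E n)) :=
  (fun x : E n => (x : OnePoint (E n))) '' G

/-- On the set `G`, the quasi-inversion `f` in the boundary of `D` is a `C`-bi-Lipschitz map onto
`f G` with respect to both the Möbius metrics and Ferrand's metrics of `G` and `f G`. -/
def QuasiInversionIsBiLipschitz {n : ℕ} (D G : Set (E n)) (C : ℝ) : Prop :=
  IsBiLipschitzOn C (mobiusDist (toExt G)) (mobiusDist (quasiInversion D '' toExt G))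
    (quasiInversion D) (toExt G) ∧
  IsBiLipschitzOn C (ferrandDist (toExt G)) (ferrandDist (quasiInversion D '' toExt G))
    (quasiInversion D) (toExt G)

end QuasiInv

end

/-! Write `φ` for the radial extension and `ι` for inversion in the unit sphere. The quasi-inversion
is the conjugate `φ ∘ ι ∘ φ⁻¹`. If `φ` and `φ⁻¹` are `L`-Lipschitz, the identity `|ι u - ι v| = |u -
v| / (|u| |v|)` gives `|f x - f y| ≤ L² w(x) w(y) |x - y|` with `w(x) = r_x / |x|`
(`gap_quasiInversion_le`). Since `f` is an involution and `w(f x) = 1 / w(x)`, the matching lower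
bound follows. In an absolute ratio all weights cancel and each of the four factors costs `L²`,
giving `L⁸`; Bernoulli's inequality carries this factor through the logarithm in `δ`. In Ferrand's
density three factors give `L⁶ / w²`, and the arc length element gives `L² w²`, so the product is
again `L⁸`. Boundaries are matched because `f` is a homeomorphism of the compactified space.

That `φ` and `φ⁻¹` are `L`-Lipschitz comes from the tangent condition. It bounds the logarithmic
slope of `r_x` transverse to `x` by `cot α` (`TangentCondition.hasSlopeBound`), so to first order
`φ` is `r_x` times a shear with parameter at most `cot α`. The norm of that shear is half the
bracket in `L`; the extrema of `r_x` and `1 / r_x` supply the other factors. Pointwise Lipschitz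
bounds become global along segments.

For the convergence statement, homogeneity spreads the bound on `φ' - I` from the sphere to almost
every point, and Fubini on parallel segments makes `φ - id` globally `ε`-Lipschitz
(`norm_extension_sub_le`). Then the boundary radii lie within `ε` of `1` and the boundary is nearly
orthogonal to rays, so `L_t` is at most an explicit continuous function of `ε` with value `1` at
`0`, while `L_t ≥ 1` always. -/

noncomputable section

namespace QuasiInv

/-! ### Lipschitz bounds from pointwise information -/

/-- A map between normed spaces whose pointwise Lipschitz constants are at most `K` is
`K`-Lipschitz. -/
theorem norm_sub_le_of_forall_eventually {V W : Type*} [NormedAddCommGroup V] [NormedSpace ℝ V]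
    [NormedAddCommGroup W] [NormedSpace ℝ W] {f : V → W} {K : ℝ}
    (hf : ∀ x, ∀ K' > K, ∀ᶠ y in 𝓝 x, ‖f y - f x‖ ≤ K' * ‖y - x‖) (x y : V) :
    ‖f y - f x‖ ≤ K * ‖y - x‖ := by
  rcases eq_or_ne y x with rfl | hxy
  · simp
  have hpos : 0 < ‖y - x‖ := norm_pos_iff.2 (sub_ne_zero.2 hxy)
  have hcont : Continuous f := by
    refine continuous_iff_continuousAt.2 fun z => tendsto_iff_norm_sub_tendsto_zero.2 ?_
    refine squeeze_zero' (Eventually.of_forall fun _ => norm_nonneg _) (hf z (K + 1) (by simp)) ?_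
    have : Tendsto (fun y : V => (K + 1) * ‖y - z‖) (𝓝 z) (𝓝 ((K + 1) * ‖z - z‖)) :=
      (by fun_prop : Continuous fun y : V => (K + 1) * ‖y - z‖).tendsto z
    simpa using this
  have main : ∀ K' > K, ‖f y - f x‖ ≤ K' * ‖y - x‖ := by
    intro K' hK'
    -- The boundary comparison lemma needs slopes strictly below the derivative of the bound, so the
    -- slope is controlled by `K''` and the bound grows with `K'`.
    obtain ⟨K'', h1, h2⟩ := exists_between hK'
    have hl : Continuous fun t : ℝ => x + t • (y - x) := by fun_prop
    have := image_norm_le_of_liminf_right_slope_norm_lt_deriv_boundary (a := (0 : ℝ)) (b := 1)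
      (f := fun t => f (x + t • (y - x)) - f x) (f' := fun _ => K'' * ‖y - x‖)
      (B := fun t => K' * ‖y - x‖ * t) (B' := fun _ => K' * ‖y - x‖)
      ((hcont.comp hl).sub continuous_const).continuousOn ?_ (by simp) (by fun_prop) ?_ ?_
      (right_mem_Icc.2 zero_le_one)
    · simpa using this
    · intro t _ r hr
      have h3 : ∀ᶠ z in 𝓝[>] t, ‖f (x + z • (y - x)) - f (x + t • (y - x))‖ ≤
          K'' * ‖(x + z • (y - x)) - (x + t • (y - x))‖ :=
        ((hl.tendsto t).eventually (hf _ K'' h1)).filter_mono nhdsWithin_le_nhds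
      refine Eventually.frequently ?_
      filter_upwards [h3, self_mem_nhdsWithin] with z hz hzt
      have hzt' : 0 < z - t := sub_pos.2 hzt
      have e : (x + z • (y - x)) - (x + t • (y - x)) = (z - t) • (y - x) := by module
      rw [e, norm_smul, Real.norm_of_nonneg hzt'.le] at hz
      rw [slope_def_field]
      refine lt_of_le_of_lt ?_ hr
      rw [div_le_iff₀ hzt']
      have := norm_sub_norm_le (f (x + z • (y - x)) - f x) (f (x + t • (y - x)) - f x)
      rw [sub_sub_sub_cancel_right] at this
      simp only [Function.comp]
      nlinarith
    · intro t _
      simpa using ((hasDerivAt_id t).const_mul (K' * ‖y - x‖)).hasDerivWithinAt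
    · intro t _ _
      exact mul_lt_mul_of_pos_right h2 hpos
  refine le_of_forall_gt_imp_ge_of_dense fun b hb => ?_
  have := main (b / ‖y - x‖) (by rwa [gt_iff_lt, lt_div_iff₀ hpos])
  rwa [div_mul_cancel₀ _ hpos.ne'] at this

/-! ### Norm of a planar shear -/

/-- The largest singular value of the shear with parameter `c`. -/
def shearNorm (c : ℝ) : ℝ := (c + √(c ^ 2 + 4)) / 2

theorem continuous_shearNorm : Continuous shearNorm := by
  unfold shearNorm
  fun_prop

theorem one_le_shearNorm {c : ℝ} (hc : 0 ≤ c) : 1 ≤ shearNorm c := by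
  have : 2 ≤ √(c ^ 2 + 4) := Real.le_sqrt_of_sq_le (by nlinarith)
  unfold shearNorm
  linarith

theorem shearNorm_sq (c : ℝ) : shearNorm c ^ 2 = c * shearNorm c + 1 := by
  have : √(c ^ 2 + 4) ^ 2 = c ^ 2 + 4 := Real.sq_sqrt (by positivity)
  unfold shearNorm
  nlinarith

/-- The worst case is `e = ± c q`. There `s² = c s + 1`, with `s = shearNorm c`, turns `s` times the
deficit into the perfect square `c (s |p| - q)²`. -/
theorem shear_sq_le {c p q e : ℝ} (hc : 0 ≤ c) (he : |e| ≤ c * q) :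
    (p + e) ^ 2 + q ^ 2 ≤ shearNorm c ^ 2 * (p ^ 2 + q ^ 2) := by
  have hs := shearNorm_sq c
  have hs1 := one_le_shearNorm hc
  set s := shearNorm c
  have h1 : (p + e) ^ 2 ≤ (|p| + c * q) ^ 2 := by
    rw [← sq_abs (p + e)]
    have : |p + e| ≤ |p| + c * q := (abs_add_le p e).trans (by gcongr)
    gcongr
  have h2 : (|p| + c * q) ^ 2 + q ^ 2 ≤ s ^ 2 * (|p| ^ 2 + q ^ 2) := by
    have key : s * (s ^ 2 * (|p| ^ 2 + q ^ 2) - ((|p| + c * q) ^ 2 + q ^ 2))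
        = c * (s * |p| - q) ^ 2 := by
      linear_combination (s * |p| ^ 2 + (s + c) * q ^ 2) * hs
    have : 0 ≤ s * (s ^ 2 * (|p| ^ 2 + q ^ 2) - ((|p| + c * q) ^ 2 + q ^ 2)) := by
      rw [key]; positivity
    nlinarith [nonneg_of_mul_nonneg_right this (by linarith)]
  rw [sq_abs] at h2
  linarith

/-- Norm bound for a sheared vector: `u` is a unit vector, and the added multiple `e` of `u` is
controlled by the component of `h` orthogonal to `u`. -/
theorem norm_add_smul_le_shearNorm {V : Type*} [NormedAddCommGroup V] [InnerProductSpace ℝ V]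
    {u h : V} {c e : ℝ} (hu : ‖u‖ = 1) (hc : 0 ≤ c)
    (he : |e| ≤ c * ‖h - (inner ℝ u h) • u‖) : ‖h + e • u‖ ≤ shearNorm c * ‖h‖ := by
  set p := inner ℝ u h with hp
  have h1 : ∀ r : ℝ, ‖(h - p • u) + r • u‖ ^ 2 = ‖h - p • u‖ ^ 2 + r ^ 2 := by
    intro r
    have h0 : inner ℝ (h - p • u) u = 0 := by
      rw [inner_sub_left, inner_smul_left, real_inner_self_eq_norm_sq, hu, real_inner_comm]
      simp [hp]
    rw [norm_add_sq_real, inner_smul_right, h0, norm_smul, hu]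
    simp
  have h2 := h1 p
  have h3 := h1 (p + e)
  have e2 : (h - p • u) + p • u = h := by module
  have e3 : (h - p • u) + (p + e) • u = h + e • u := by module
  rw [e2] at h2
  rw [e3] at h3
  have h4 := shear_sq_le (p := p) hc he
  have hs := one_le_shearNorm hc
  refine abs_le_of_sq_le_sq' ?_ (by positivity) |>.2
  nlinarith

/-! ### The polar radius of a strictly starlike domain -/

section Polar

variable {n : ℕ} {D : Set (E n)}

theorem polarRadius_eq (hD : IsStrictlyStarlike D) {x w : E n} (hx : x ≠ 0) (hw : w ∈ frontier D)
    {t : ℝ} (ht : 0 < t) (h : w = t • x) : polarRadius D x = ‖w‖ := by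
  obtain ⟨w', _, huniq⟩ := hD.existsUnique_ray x hx
  have hww : w = w' := huniq w ⟨hw, t, ht, h⟩
  have : {ρ : ℝ | ∃ w ∈ frontier D, (∃ t : ℝ, 0 < t ∧ w = t • x) ∧ ρ = ‖w‖} = {‖w‖} := by
    ext ρ
    constructor
    · rintro ⟨v, hv, hv', rfl⟩
      rw [hww, huniq v ⟨hv, hv'⟩]
      rfl
    · rintro rfl
      exact ⟨w, hw, ⟨t, ht, h⟩, rfl⟩
  rw [polarRadius, this, csSup_singleton]

theorem zero_notMem_frontier (hD : IsStrictlyStarlike D) : (0 : E n) ∉ frontier D := fun h =>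
  (hD.isOpen.frontier_eq ▸ h).2 hD.zero_mem

theorem polarRadius_of_mem (hD : IsStrictlyStarlike D) {w : E n} (hw : w ∈ frontier D) :
    polarRadius D w = ‖w‖ :=
  polarRadius_eq hD (fun h => zero_notMem_frontier hD (h ▸ hw)) hw one_pos (one_smul ℝ w).symm

theorem polarRadius_pos (hD : IsStrictlyStarlike D) {x : E n} (hx : x ≠ 0) :
    0 < polarRadius D x := by
  obtain ⟨w, ⟨hw, t, ht, h⟩, _⟩ := hD.existsUnique_ray x hx
  rw [polarRadius_eq hD hx hw ht h, h]
  exact norm_pos_iff.2 (smul_ne_zero ht.ne' hx)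

theorem polarRadius_smul_mem (hD : IsStrictlyStarlike D) {x : E n} (hx : x ≠ 0) :
    (polarRadius D x / ‖x‖) • x ∈ frontier D := by
  obtain ⟨w, ⟨hw, t, ht, h⟩, _⟩ := hD.existsUnique_ray x hx
  have hn : ‖x‖ ≠ 0 := norm_ne_zero_iff.2 hx
  rw [polarRadius_eq hD hx hw ht h]
  have : ‖w‖ / ‖x‖ = t := by
    rw [h, norm_smul, Real.norm_of_nonneg ht.le, mul_div_cancel_right₀ _ hn]
  rwa [this, ← h]

theorem polarRadius_smul (D : Set (E n)) {c : ℝ} (hc : 0 < c) (x : E n) :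
    polarRadius D (c • x) = polarRadius D x := by
  unfold polarRadius
  congr 1
  ext ρ
  refine exists_congr fun w => and_congr_right fun _ => and_congr_left fun _ => ?_
  constructor
  · rintro ⟨t, ht, h⟩
    exact ⟨t * c, mul_pos ht hc, by rw [h, smul_smul]⟩
  · rintro ⟨t, ht, h⟩
    exact ⟨t / c, div_pos ht hc, by rw [h, smul_smul, div_mul_cancel₀ _ hc.ne']⟩

theorem isCompact_frontier (hD : IsStrictlyStarlike D) : IsCompact (frontier D) :=
  Metric.isCompact_of_isClosed_isBounded isClosed_frontier
    (hD.isBounded.closure.subset frontier_subset_closure)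

/-- Radial projection is a continuous bijection from the compact boundary onto the unit sphere,
hence a homeomorphism. The polar radius on the sphere is the norm of its inverse, and homogeneity of
degree `0` extends continuity off the sphere. -/
theorem continuousAt_polarRadius (hD : IsStrictlyStarlike D) {x : E n} (hx : x ≠ 0) :
    ContinuousAt (polarRadius D) x := by
  have hnz : ∀ w : frontier D, (w : E n) ≠ 0 := fun w h => zero_notMem_frontier hD (h ▸ w.2)
  have hsz : ∀ v : Metric.sphere (0 : E n) 1, (v : E n) ≠ 0 := fun v =>
    ne_zero_of_mem_unit_sphere v
  let e : frontier D ≃ Metric.sphere (0 : E n) 1 :=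
    { toFun := fun w => ⟨‖(w : E n)‖⁻¹ • (w : E n), by
        simp [norm_smul, inv_mul_cancel₀ (norm_ne_zero_iff.2 (hnz w))]⟩
      invFun := fun v => ⟨polarRadius D v • (v : E n), by
        simpa using polarRadius_smul_mem hD (hsz v)⟩
      left_inv := fun w => by
        have hw := norm_pos_iff.2 (hnz w)
        ext1
        simp only
        rw [polarRadius_smul D (inv_pos.2 hw), polarRadius_of_mem hD w.2, smul_smul,
          mul_inv_cancel₀ hw.ne', one_smul]
      right_inv := fun v => by
        have hv := polarRadius_pos hD (hsz v)
        ext1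
        simp [norm_smul, abs_of_pos hv, smul_smul, inv_mul_cancel₀ hv.ne'] }
  have : CompactSpace (frontier D) := isCompact_iff_compactSpace.1 (isCompact_frontier hD)
  have he : Continuous e := by
    refine Continuous.subtype_mk ?_ _
    exact (continuous_subtype_val.norm.inv₀ fun w => norm_ne_zero_iff.2 (hnz w)).smul
      continuous_subtype_val
  have hsymm : Continuous e.symm := (Continuous.homeoOfEquivCompactToT2 he).symm.continuous
  have h1 : Continuous fun v : Metric.sphere (0 : E n) 1 => polarRadius D (v : E n) := by
    have : (fun v : Metric.sphere (0 : E n) 1 => polarRadius D (v : E n)) =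
        fun v => ‖((e.symm v : frontier D) : E n)‖ := by
      funext v
      change _ = ‖polarRadius D v • (v : E n)‖
      rw [norm_smul, norm_eq_of_mem_sphere, mul_one,
        Real.norm_of_nonneg (polarRadius_pos hD (hsz v)).le]
    rw [this]
    exact (continuous_subtype_val.comp hsymm).norm
  have h2 : Continuous fun y : {y : E n // y ≠ 0} => polarRadius D (y : E n) := by
    have hp : ∀ y : {y : E n // y ≠ 0}, ‖(y : E n)‖⁻¹ • (y : E n) ∈ Metric.sphere (0 : E n) 1 :=
      fun y => by simp [norm_smul, inv_mul_cancel₀ (norm_ne_zero_iff.2 y.2)]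
    have h3 : Continuous fun y : {y : E n // y ≠ 0} =>
        (⟨‖(y : E n)‖⁻¹ • (y : E n), hp y⟩ : Metric.sphere (0 : E n) 1) :=
      Continuous.subtype_mk ((continuous_subtype_val.norm.inv₀ fun w =>
        norm_ne_zero_iff.2 w.2).smul continuous_subtype_val) _
    refine (h1.comp h3).congr fun y => ?_
    exact polarRadius_smul D (inv_pos.2 (norm_pos_iff.2 y.2)) _
  exact (continuousOn_iff_continuous_domRestrict.2 h2 : ContinuousOn (polarRadius D) {y | y ≠ 0})
    |>.continuousAt (isOpen_ne.mem_nhds hx)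

/-- The inverse of the radial extension. -/
def radialContraction (D : Set (E n)) (x : E n) : E n := (polarRadius D x)⁻¹ • x

theorem sInf_norm_frontier_le (w : E n) (hw : w ∈ frontier D) :
    sInf (norm '' frontier D) ≤ ‖w‖ :=
  csInf_le ⟨0, by rintro _ ⟨w, _, rfl⟩; exact norm_nonneg w⟩ ⟨w, hw, rfl⟩

theorem norm_le_sSup_norm_frontier (hD : IsStrictlyStarlike D) (w : E n) (hw : w ∈ frontier D) :
    ‖w‖ ≤ sSup (norm '' frontier D) :=
  le_csSup ((isCompact_frontier hD).image continuous_norm).bddAbove ⟨w, hw, rfl⟩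

theorem frontier_nonempty (hD : IsStrictlyStarlike D) (hn : 2 ≤ n) : (frontier D).Nonempty := by
  have : Nontrivial (E n) := by
    have : Nontrivial (Fin n) := Fin.nontrivial_iff_two_le.2 hn
    have : Nonempty (Fin n) := inferInstance
    infer_instance
  obtain ⟨x, hx⟩ := exists_ne (0 : E n)
  exact ⟨_, polarRadius_smul_mem hD hx⟩

theorem sInf_norm_frontier_pos (hD : IsStrictlyStarlike D) (hn : 2 ≤ n) :
    0 < sInf (norm '' frontier D) := by
  obtain ⟨w, hw, h⟩ := ((isCompact_frontier hD).image continuous_norm).sInf_mem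
    ((frontier_nonempty hD hn).image _)
  rw [← h]
  exact norm_pos_iff.2 fun h => zero_notMem_frontier hD (h ▸ hw)

theorem norm_polarRadius_smul (hD : IsStrictlyStarlike D) {x : E n} (hx : x ≠ 0) :
    ‖(polarRadius D x / ‖x‖) • x‖ = polarRadius D x := by
  rw [norm_smul, norm_div, norm_norm, div_mul_cancel₀ _ (norm_ne_zero_iff.2 hx),
    Real.norm_of_nonneg (polarRadius_pos hD hx).le]

theorem sInf_le_polarRadius (hD : IsStrictlyStarlike D) {x : E n} (hx : x ≠ 0) :
    sInf (norm '' frontier D) ≤ polarRadius D x :=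
  norm_polarRadius_smul hD hx ▸ sInf_norm_frontier_le _ (polarRadius_smul_mem hD hx)

theorem polarRadius_le_sSup (hD : IsStrictlyStarlike D) {x : E n} (hx : x ≠ 0) :
    polarRadius D x ≤ sSup (norm '' frontier D) :=
  norm_polarRadius_smul hD hx ▸ norm_le_sSup_norm_frontier hD _ (polarRadius_smul_mem hD hx)

end Polar

/-! ### From the tangent condition to Lipschitz bounds for the radial extension -/

section Cone

variable {n : ℕ} {D : Set (E n)}

/-- The component of `y` orthogonal to the direction of `x`. -/
def perp (x y : E n) : E n := y - (inner ℝ (‖x‖⁻¹ • x) y) • (‖x‖⁻¹ • x)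

theorem norm_inv_smul_self {x : E n} (hx : x ≠ 0) : ‖‖x‖⁻¹ • x‖ = 1 := by
  simp [norm_smul, inv_mul_cancel₀ (norm_ne_zero_iff.2 hx)]

theorem norm_sq_eq_perp {x : E n} (hx : x ≠ 0) (y : E n) :
    ‖y‖ ^ 2 = (inner ℝ (‖x‖⁻¹ • x) y) ^ 2 + ‖perp x y‖ ^ 2 := by
  have hu := norm_inv_smul_self hx
  unfold perp
  set u := ‖x‖⁻¹ • x
  rw [norm_sub_sq_real, inner_smul_right, norm_smul, hu, real_inner_comm]
  simp
  ring

theorem norm_perp_le {x : E n} (hx : x ≠ 0) (y : E n) : ‖perp x y‖ ≤ ‖y‖ := by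
  refine abs_le_of_sq_le_sq' ?_ (norm_nonneg _) |>.2
  nlinarith [norm_sq_eq_perp hx y]

theorem perp_self {x : E n} (hx : x ≠ 0) : perp x x = 0 := by
  have hn : ‖x‖ ≠ 0 := norm_ne_zero_iff.2 hx
  unfold perp
  rw [real_inner_smul_left, real_inner_self_eq_norm_sq, smul_smul]
  have : ‖x‖⁻¹ * ‖x‖ ^ 2 * ‖x‖⁻¹ = 1 := by field_simp
  rw [this, one_smul, sub_self]

theorem perp_smul (x y : E n) (r : ℝ) : perp x (r • y) = r • perp x y := by
  unfold perp
  rw [inner_smul_right]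
  module

theorem perp_sub (x y z : E n) : perp x (y - z) = perp x y - perp x z := by
  unfold perp
  rw [inner_sub_right]
  module

theorem perp_smul_left {r : ℝ} (hr : 0 < r) (x y : E n) : perp (r • x) y = perp x y := by
  unfold perp
  have : ‖r • x‖⁻¹ • (r • x) = ‖x‖⁻¹ • x := by
    rw [norm_smul, Real.norm_of_nonneg hr.le, smul_smul, mul_inv, mul_right_comm,
      inv_mul_cancel₀ hr.ne', one_mul]
  rw [this]

theorem continuous_perp (x : E n) : Continuous (perp x) := by
  unfold perp
  fun_prop

/-- Pointwise bound for the logarithmic derivative of `ρ` in directions orthogonal to the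
position vector. -/
def HasSlopeBound (ρ : E n → ℝ) (c : ℝ) : Prop :=
  ∀ x ≠ 0, ∀ c' > c, ∀ᶠ y in 𝓝 x, |ρ y - ρ x| ≤ c' * ρ x * (‖perp x y‖ / ‖x‖)

/-- The bound concerns `log ρ` up to sign. Replacing `ρ x` by `ρ y` costs only the slack between
`c''` and `c'`, by continuity. -/
theorem HasSlopeBound.inv {ρ : E n → ℝ} {c : ℝ} (h : HasSlopeBound ρ c)
    (hpos : ∀ x ≠ 0, 0 < ρ x) (hcont : ∀ x ≠ 0, ContinuousAt ρ x) :
    HasSlopeBound (fun x => (ρ x)⁻¹) c := by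
  intro x hx c' hc'
  obtain ⟨c'', h1, h2⟩ := exists_between hc'
  have hx0 := hpos x hx
  have h3 : ∀ᶠ y in 𝓝 x, c'' * ρ x < c' * ρ y :=
    (tendsto_const_nhds.mul (hcont x hx)).eventually_const_lt (mul_lt_mul_of_pos_right h2 hx0)
  filter_upwards [h x hx c'' h1, h3, isOpen_ne.mem_nhds hx] with y hy hy3 hy0
  have hy1 := hpos y hy0
  set T := ‖perp x y‖ / ‖x‖
  have hT : 0 ≤ T := by positivity
  have e : (ρ y)⁻¹ - (ρ x)⁻¹ = (ρ x - ρ y) / (ρ x * ρ y) := by field_simp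
  rw [e, abs_div, abs_sub_comm, abs_of_pos (mul_pos hx0 hy1), div_le_iff₀ (mul_pos hx0 hy1)]
  have : c' * (ρ x)⁻¹ * T * (ρ x * ρ y) = c' * ρ y * T := by field_simp
  rw [this]
  exact hy.trans (mul_le_mul_of_nonneg_right hy3.le hT)

/-- Away from the origin the increment of `x ↦ ρ x • x` is `ρ x` times a shear of `y - x` along `x`,
plus a remainder of second order. At the origin `ρ ≤ R` suffices. -/
theorem HasSlopeBound.norm_smul_sub_le {ρ : E n → ℝ} {c R : ℝ} (h : HasSlopeBound ρ c)
    (hc : 0 ≤ c) (hpos : ∀ x ≠ 0, 0 < ρ x) (hR : ∀ x ≠ 0, ρ x ≤ R) (x y : E n) :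
    ‖ρ y • y - ρ x • x‖ ≤ R * shearNorm c * ‖y - x‖ := by
  have hs := one_le_shearNorm hc
  refine norm_sub_le_of_forall_eventually (f := fun x => ρ x • x) ?_ x y
  clear x y
  intro x K hK
  rcases eq_or_ne x 0 with rfl | hx
  · refine Eventually.of_forall fun y => ?_
    rcases eq_or_ne y 0 with rfl | hy
    · simp
    · have h1 := hpos y hy
      have h2 := hR y hy
      simp only [smul_zero, sub_zero, norm_smul, Real.norm_of_nonneg h1.le]
      gcongr
      nlinarith
  · have hx0 := hpos x hx
    have hxn : 0 < ‖x‖ := norm_pos_iff.2 hx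
    have h1 : ρ x * shearNorm c < K := lt_of_le_of_lt (by gcongr; exact hR x hx) hK
    obtain ⟨c', h2, h3⟩ : ∃ c', ρ x * shearNorm c' < K ∧ c < c' := by
      have : ∀ᶠ c' in 𝓝[>] c, ρ x * shearNorm c' < K :=
        ((continuous_const.mul continuous_shearNorm).tendsto c).eventually_lt_const h1
          |>.filter_mono nhdsWithin_le_nhds
      exact (this.and self_mem_nhdsWithin).exists
    have hc' : 0 ≤ c' := hc.trans h3.le
    have h4 : ∀ᶠ y in 𝓝 x, ρ x * (shearNorm c' + c' * ‖y - x‖ / ‖x‖) < K := by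
      have : Continuous fun y => ρ x * (shearNorm c' + c' * ‖y - x‖ / ‖x‖) := by fun_prop
      exact (this.tendsto x).eventually_lt_const (by simpa using h2)
    filter_upwards [h x hx c' h3, h4] with y hy hy4
    set u := ‖x‖⁻¹ • x with hu
    set e := (ρ y - ρ x) * ‖x‖ / ρ x with he
    have hp : perp x (y - x) = perp x y := by rw [perp_sub, perp_self hx, sub_zero]
    have heb : |e| ≤ c' * ‖perp x (y - x)‖ := by
      rw [hp, he, abs_div, abs_mul, abs_of_pos hx0, abs_of_pos hxn, div_le_iff₀ hx0]
      calc |ρ y - ρ x| * ‖x‖ ≤ c' * ρ x * (‖perp x y‖ / ‖x‖) * ‖x‖ := by gcongr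
        _ = c' * ‖perp x y‖ * ρ x := by field_simp
    -- The scalar `e` is normalised so that `ρ x * e / ‖x‖ = ρ y - ρ x`; the last term is thus a
    -- product of two small increments and the identity is exact.
    have key : ρ y • y - ρ x • x = ρ x • ((y - x) + e • u) + (ρ x * e / ‖x‖) • (y - x) := by
      rw [hu, smul_add, smul_smul, smul_smul]
      have e1 : ρ x * e * ‖x‖⁻¹ = ρ y - ρ x := by rw [he]; field_simp
      have e2 : ρ x * e / ‖x‖ = ρ y - ρ x := by rw [he]; field_simp
      rw [e1, e2]
      module
    have h5 := norm_add_smul_le_shearNorm (h := y - x) (norm_inv_smul_self hx) hc' heb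
    have h6 : |e| ≤ c' * ‖y - x‖ := heb.trans (by gcongr; exact norm_perp_le hx _)
    calc ‖ρ y • y - ρ x • x‖
        ≤ ρ x * (shearNorm c' * ‖y - x‖) + ρ x * (c' * ‖y - x‖) / ‖x‖ * ‖y - x‖ := by
          rw [key]
          refine (norm_add_le _ _).trans ?_
          rw [norm_smul, norm_smul, Real.norm_of_nonneg hx0.le, norm_div, norm_mul, norm_norm,
            Real.norm_of_nonneg hx0.le, Real.norm_eq_abs]
          gcongr
      _ = ρ x * (shearNorm c' + c' * ‖y - x‖ / ‖x‖) * ‖y - x‖ := by ring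
      _ ≤ K * ‖y - x‖ := by gcongr

/-- The cotangent of the angle, written as in the constant `L`. -/
def cotBound (α : ℝ) : ℝ := √((1 / Real.sin α) ^ 2 - 1)

/-- Near `w` the boundary stays outside the double cone at `w` around the ray with half-angle `β`,
for `β < α`. Outside that cone the axial displacement is at most `cot β` times the transverse one.
-/
theorem TangentCondition.eventually_inner_le (hD : IsStrictlyStarlike D) {α : ℝ}
    (h : TangentCondition D α) {w : E n} (hw : w ∈ frontier D) {c : ℝ} (hc : cotBound α < c) :
    ∀ᶠ z in 𝓝[frontier D] w, |inner ℝ (‖w‖⁻¹ • w) (z - w)| ≤ c * ‖perp w (z - w)‖ := by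
  obtain ⟨hα0, hα1, hα⟩ := h
  have hw0 : w ≠ 0 := fun h => zero_notMem_frontier hD (h ▸ hw)
  have hsin : 0 < Real.sin α := Real.sin_pos_of_pos_of_lt_pi hα0 (by linarith [Real.pi_pos])
  -- A lower limit at least `α` only controls angles strictly below `α`; continuity of the cotangent
  -- lets `β` absorb the slack in `c`.
  obtain ⟨β, ⟨hβc, hβ0⟩, hβα⟩ : ∃ β, (cotBound β < c ∧ 0 < β) ∧ β < α := by
    have h1 : ContinuousAt cotBound α := by
      unfold cotBound
      have : Real.sin α ≠ 0 := hsin.ne'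
      fun_prop (disch := assumption)
    have h2 : ∀ᶠ β in 𝓝[<] α, cotBound β < c ∧ 0 < β :=
      ((h1.tendsto.eventually_lt_const hc).and (eventually_gt_nhds hα0)).filter_mono
        nhdsWithin_le_nhds
    exact (h2.and self_mem_nhdsWithin).exists
  have hsβ : 0 < Real.sin β := Real.sin_pos_of_pos_of_lt_pi hβ0 (by linarith [Real.pi_pos])
  have h3 : ∀ᶠ z in 𝓝[frontier D \ {w}] w, β < acuteAngle (z - w) w := by
    refine eventually_lt_of_lt_liminf (hβα.trans_le (hα w hw)) ?_
    refine isBoundedUnder_of ⟨0, fun z => ?_⟩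
    exact le_min (InnerProductGeometry.angle_nonneg _ _)
      (sub_nonneg.2 (InnerProductGeometry.angle_le_pi _ _))
  rw [eventually_nhdsWithin_iff] at h3 ⊢
  filter_upwards [h3] with z hz hzM
  rcases eq_or_ne z w with rfl | hzw
  · have h0 : (0 : ℝ) ≤ cotBound α := Real.sqrt_nonneg _
    simp only [sub_self, inner_zero_right, abs_zero]
    exact mul_nonneg (h0.trans hc.le) (norm_nonneg _)
  have hz := hz ⟨hzM, hzw⟩
  have hsq := norm_sq_eq_perp hw0 (z - w)
  set a := inner ℝ (‖w‖⁻¹ • w) (z - w) with ha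
  set b := ‖perp w (z - w)‖
  have hb : 0 ≤ b := norm_nonneg _
  have hwn : 0 < ‖w‖ := norm_pos_iff.2 hw0
  have ha' : a = ‖z - w‖ * Real.cos (InnerProductGeometry.angle (z - w) w) := by
    have := InnerProductGeometry.cos_angle_mul_norm_mul_norm (z - w) w
    rw [ha, real_inner_smul_left, real_inner_comm, ← this]
    field_simp
  set θ := InnerProductGeometry.angle (z - w) w
  have hθ0 : 0 ≤ θ := InnerProductGeometry.angle_nonneg _ _
  have hθ1 : θ ≤ Real.pi := InnerProductGeometry.angle_le_pi _ _
  have hz1 : β < θ := hz.trans_le (min_le_left _ _)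
  have hz2 : β < Real.pi - θ := hz.trans_le (min_le_right _ _)
  have hcos : |Real.cos θ| ≤ Real.cos β := by
    rw [abs_le]
    constructor
    · rw [neg_le, ← Real.cos_pi_sub]
      exact Real.cos_le_cos_of_nonneg_of_le_pi hβ0.le (by linarith) hz2.le
    · exact Real.cos_le_cos_of_nonneg_of_le_pi hβ0.le hθ1 hz1.le
  have h4 : a ^ 2 ≤ Real.cos β ^ 2 * (a ^ 2 + b ^ 2) := by
    rw [← hsq, ha', mul_pow, mul_comm]
    gcongr ?_ * _
    exact sq_le_sq' (abs_le.1 hcos).1 (abs_le.1 hcos).2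
  have h5 : a ^ 2 ≤ ((1 / Real.sin β) ^ 2 - 1) * b ^ 2 := by
    have h6 := Real.sin_sq_add_cos_sq β
    have : a ^ 2 * Real.sin β ^ 2 ≤ (1 - Real.sin β ^ 2) * b ^ 2 := by nlinarith
    have e : ((1 / Real.sin β) ^ 2 - 1) * b ^ 2
        = ((1 - Real.sin β ^ 2) * b ^ 2) / Real.sin β ^ 2 := by field_simp
    rw [e, le_div_iff₀ (by positivity)]
    exact this
  have h7 : |a| ≤ cotBound β * b := by
    rw [← Real.sqrt_sq_eq_abs, cotBound]
    conv_rhs => rw [← Real.sqrt_sq hb]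
    rw [← Real.sqrt_mul' _ (sq_nonneg b)]
    exact Real.sqrt_le_sqrt h5
  exact h7.trans (by gcongr)

theorem TangentCondition.hasSlopeBound (hD : IsStrictlyStarlike D) {α : ℝ}
    (h : TangentCondition D α) : HasSlopeBound (polarRadius D) (cotBound α) := by
  intro x hx c' hc'
  obtain ⟨c, hc, hcc'⟩ := exists_between hc'
  have hc0 : 0 ≤ c := (Real.sqrt_nonneg _).trans hc.le
  have hxn : 0 < ‖x‖ := norm_pos_iff.2 hx
  have hR := polarRadius_pos hD hx
  have hcont := continuousAt_polarRadius hD hx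
  set ρ := polarRadius D with hρ
  set w := (ρ x / ‖x‖) • x with hw
  have hwM : w ∈ frontier D := polarRadius_smul_mem hD hx
  have hxn' : ‖x‖ ≠ 0 := hxn.ne'
  have hz : Tendsto (fun y => (ρ y / ‖y‖) • y) (𝓝 x) (𝓝[frontier D] w) := by
    refine tendsto_nhdsWithin_iff.2 ⟨?_, ?_⟩
    · exact ((hcont.div continuous_norm.continuousAt hxn').smul continuousAt_id)
    · filter_upwards [isOpen_ne.mem_nhds hx] with y hy using polarRadius_smul_mem hD hy
  have h1 := hz.eventually (h.eventually_inner_le hD hwM hc)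
  -- This is the coefficient of `‖perp x y‖` in the final estimate; its limit as `y → x` is `c * ρ x
  -- / ‖x‖`.
  have hF : ∀ᶠ y in 𝓝 x, ρ y / ‖y‖ * (2 * ρ x * c + (c ^ 2 + 1) * (ρ y / ‖y‖ * ‖perp x y‖)) /
      (ρ y + ρ x) < c' * ρ x / ‖x‖ := by
    have hp := (continuous_perp x).continuousAt (x := x)
    have hne : ρ x + ρ x ≠ 0 := by positivity
    have hC : ContinuousAt (fun y => ρ y / ‖y‖ * (2 * ρ x * c + (c ^ 2 + 1) *
        (ρ y / ‖y‖ * ‖perp x y‖)) / (ρ y + ρ x)) x := by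
      fun_prop (disch := assumption)
    refine hC.tendsto.eventually_lt_const ?_
    rw [perp_self hx]
    have : ρ x / ‖x‖ * (2 * ρ x * c + (c ^ 2 + 1) * (ρ x / ‖x‖ * ‖(0 : E n)‖)) / (ρ x + ρ x)
        = c * ρ x / ‖x‖ := by
      rw [norm_zero]; field_simp; ring
    rw [this]
    gcongr
  filter_upwards [h1, hF, isOpen_ne.mem_nhds hx] with y hy1 hy2 hy0
  have hyn : 0 < ‖y‖ := norm_pos_iff.2 hy0
  have hRy : 0 < ρ y := polarRadius_pos hD hy0
  have hw0 : w ≠ 0 := fun h => zero_notMem_frontier hD (h ▸ hwM)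
  have hsq := norm_sq_eq_perp hw0 ((ρ y / ‖y‖) • y)
  have hnw : ‖w‖ = ρ x := norm_polarRadius_smul hD hx
  rw [norm_polarRadius_smul hD hy0] at hsq
  have hpw : perp w ((ρ y / ‖y‖) • y - w) = (ρ y / ‖y‖) • perp x y := by
    rw [perp_sub, perp_self hw0, sub_zero, perp_smul, hw, perp_smul_left (by positivity)]
  have hpz : perp w ((ρ y / ‖y‖) • y) = (ρ y / ‖y‖) • perp x y := by
    rw [perp_smul, hw, perp_smul_left (by positivity)]
  rw [hpw, inner_sub_right] at hy1
  rw [hpz] at hsq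
  have hww : inner ℝ (‖w‖⁻¹ • w) w = ρ x := by
    rw [real_inner_smul_left, real_inner_self_eq_norm_sq, hnw]
    field_simp
  rw [hww] at hy1
  rw [norm_smul (ρ y / ‖y‖), Real.norm_of_nonneg (by positivity : 0 ≤ ρ y / ‖y‖)] at hy1 hsq
  change ρ y ^ 2 = _ at hsq
  set P := inner ℝ (‖w‖⁻¹ • w) ((ρ y / ‖y‖) • y)
  set k := ρ y / ‖y‖
  set q := ‖perp x y‖
  have hq : 0 ≤ q := norm_nonneg _
  have hk : 0 < k := by positivity
  have hprod : |ρ y - ρ x| * (ρ y + ρ x) ≤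
      (k * (2 * ρ x * c + (c ^ 2 + 1) * (k * q))) * q := by
    rw [← abs_of_pos (add_pos hRy hR), ← abs_mul]
    -- The radii are compared through their squares, where Pythagoras with respect to the axis `w`
    -- is exact: `P` is the axial and `k * q` the transverse part of the boundary point over `y`.
    have e : (ρ y - ρ x) * (ρ y + ρ x) = 2 * ρ x * (P - ρ x) + (P - ρ x) ^ 2 + (k * q) ^ 2 := by
      linear_combination hsq
    rw [e, abs_le]
    have h8 := abs_le.1 hy1
    have h9 : (P - ρ x) ^ 2 ≤ (c * (k * q)) ^ 2 := sq_le_sq' h8.1 h8.2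
    have h10 := mul_le_mul_of_nonneg_left h8.1 hR.le
    have h11 := mul_le_mul_of_nonneg_left h8.2 hR.le
    constructor
    · nlinarith [sq_nonneg (P - ρ x), sq_nonneg (k * q), sq_nonneg (c * (k * q))]
    · nlinarith
  have hsum : 0 < ρ y + ρ x := by positivity
  rw [← le_div_iff₀ hsum] at hprod
  calc |ρ y - ρ x| ≤ _ := hprod
    _ = k * (2 * ρ x * c + (c ^ 2 + 1) * (k * q)) / (ρ y + ρ x) * q := by ring
    _ ≤ c' * ρ x / ‖x‖ * q := by gcongr
    _ = c' * ρ x * (q / ‖x‖) := by ring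

theorem cotBound_nonneg (α : ℝ) : 0 ≤ cotBound α := Real.sqrt_nonneg _

/-- Rests on `cot² α + 4 = csc² α + 3`, which identifies the bracket in `lipConst` as a singular
value. -/
theorem shearNorm_cotBound {α : ℝ} (h0 : 0 < α) (h1 : α ≤ Real.pi / 2) :
    √((1 / Real.sin α) ^ 2 - 1) + √((1 / Real.sin α) ^ 2 + 3) = 2 * shearNorm (cotBound α) := by
  have hsin : 0 < Real.sin α := Real.sin_pos_of_pos_of_lt_pi h0 (by linarith [Real.pi_pos])
  have h2 : 1 ≤ 1 / Real.sin α := by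
    rw [le_div_iff₀ hsin]
    linarith [Real.sin_le_one α]
  unfold shearNorm cotBound
  rw [Real.sq_sqrt (by nlinarith)]
  ring_nf

theorem lipConst_eq {α : ℝ} (h0 : 0 < α) (h1 : α ≤ Real.pi / 2) :
    lipConst D α = max (sSup (norm '' frontier D) * shearNorm (cotBound α))
      ((sInf (norm '' frontier D))⁻¹ * shearNorm (cotBound α)) := by
  unfold lipConst
  rw [shearNorm_cotBound h0 h1]
  congr 1
  · ring
  · rw [one_div, mul_inv]; ring

/-- The radial extension and its inverse are `L`-Lipschitz. -/
structure IsRadialBiLip (D : Set (E n)) (L : ℝ) : Prop where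
  one_le : 1 ≤ L
  pos : ∀ x ≠ 0, 0 < polarRadius D x
  extension_le : ∀ x y, ‖radialExtension D y - radialExtension D x‖ ≤ L * ‖y - x‖
  contraction_le : ∀ x y, ‖radialContraction D y - radialContraction D x‖ ≤ L * ‖y - x‖

theorem TangentCondition.isRadialBiLip (hn : 2 ≤ n) (hD : IsStrictlyStarlike D) {α : ℝ}
    (h : TangentCondition D α) : IsRadialBiLip D (lipConst D α) := by
  have hc := cotBound_nonneg α
  have hs := one_le_shearNorm hc
  have hr := sInf_norm_frontier_pos hD hn
  have hb := h.hasSlopeBound hD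
  have hpos : ∀ x ≠ 0, 0 < polarRadius D x := fun x hx => polarRadius_pos hD hx
  rw [lipConst_eq h.1 h.2.1]
  refine ⟨?_, hpos, fun x y => ?_, fun x y => ?_⟩
  · obtain ⟨w, hw⟩ := frontier_nonempty hD hn
    have h1 := sInf_norm_frontier_le w hw
    have h2 := norm_le_sSup_norm_frontier hD w hw
    -- If the largest radius is below `1`, so is the smallest, and its inverse is then at least `1`.
    rcases le_total 1 (sSup (norm '' frontier D)) with h3 | h3
    · exact le_max_of_le_left (by nlinarith)
    · refine le_max_of_le_right ?_
      have := (one_le_inv₀ hr).2 (by linarith)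
      nlinarith
  · refine (hb.norm_smul_sub_le hc hpos (fun x hx => polarRadius_le_sSup hD hx) x y).trans ?_
    gcongr
    exact le_max_left _ _
  · refine ((hb.inv hpos fun x hx => continuousAt_polarRadius hD hx).norm_smul_sub_le
      (R := (sInf (norm '' frontier D))⁻¹) hc (fun x hx => inv_pos.2 (hpos x hx))
      (fun x hx => ?_) x y).trans ?_
    · exact inv_anti₀ hr (sInf_le_polarRadius hD hx)
    · gcongr
      exact le_max_right _ _

end Cone

/-! ### Distortion of absolute ratios under the quasi-inversion -/

section Distortion

variable {n : ℕ} {D : Set (E n)} {L : ℝ}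

/-- The conformal weight of the quasi-inversion. -/
def weight (D : Set (E n)) : OnePoint (E n) → ℝ
  | ∞ => 1
  | OnePoint.some x => open Classical in if x = 0 then 1 else polarRadius D x / ‖x‖

theorem weight_infty : weight D ∞ = 1 := rfl

theorem weight_zero : weight D ((0 : E n) : OnePoint (E n)) = 1 := if_pos rfl

theorem weight_coe {x : E n} (hx : x ≠ 0) :
    weight D (x : OnePoint (E n)) = polarRadius D x / ‖x‖ := if_neg hx

theorem quasiInversion_infty : quasiInversion D ∞ = ((0 : E n) : OnePoint (E n)) := rfl

theorem quasiInversion_zero : 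
    quasiInversion D ((0 : E n) : OnePoint (E n)) = (∞ : OnePoint (E n)) := if_pos rfl

theorem quasiInversion_coe {x : E n} (hx : x ≠ 0) : quasiInversion D (x : OnePoint (E n)) =
    (((polarRadius D x ^ 2 / ‖x‖ ^ 2) • x : E n) : OnePoint (E n)) := if_neg hx

theorem gap_nonneg (x y : OnePoint (E n)) : 0 ≤ gap x y := by
  induction x using OnePoint.rec <;> induction y using OnePoint.rec <;> simp [gap]

theorem gap_coe (x y : E n) : gap (x : OnePoint (E n)) (y : OnePoint (E n)) = ‖x - y‖ := rfl

theorem gap_comm (x y : OnePoint (E n)) : gap x y = gap y x := by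
  induction x using OnePoint.rec <;> induction y using OnePoint.rec <;>
    simp [gap, norm_sub_rev]

namespace IsRadialBiLip

variable (h : IsRadialBiLip D L)

include h

theorem polarRadius_le {x : E n} (hx : x ≠ 0) : polarRadius D x ≤ L := by
  have h1 := h.extension_le 0 x
  have hxn := norm_pos_iff.2 hx
  simp only [radialExtension, smul_zero, sub_zero, norm_smul,
    Real.norm_of_nonneg (h.pos x hx).le] at h1
  exact le_of_mul_le_mul_right h1 hxn

theorem one_le_mul_polarRadius {x : E n} (hx : x ≠ 0) : 1 ≤ L * polarRadius D x := by
  have h1 := h.contraction_le 0 x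
  have hxn := norm_pos_iff.2 hx
  simp only [radialContraction, smul_zero, sub_zero, norm_smul, norm_inv,
    Real.norm_of_nonneg (h.pos x hx).le] at h1
  have := le_of_mul_le_mul_right h1 hxn
  rwa [inv_le_iff_one_le_mul₀ (h.pos x hx)] at this

theorem weight_pos (x : OnePoint (E n)) : 0 < weight D x := by
  induction x using OnePoint.rec with
  | infty => exact one_pos
  | coe x =>
    rcases eq_or_ne x 0 with rfl | hx
    · rw [weight_zero]; exact one_pos
    · rw [weight_coe hx]
      exact div_pos (h.pos x hx) (norm_pos_iff.2 hx)

theorem quasiInversion_smul_ne_zero {x : E n} (hx : x ≠ 0) :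
    (polarRadius D x ^ 2 / ‖x‖ ^ 2) • x ≠ 0 := by
  have := h.pos x hx
  have := norm_pos_iff.2 hx
  exact smul_ne_zero (by positivity) hx

theorem polarRadius_quasiInversion {x : E n} (hx : x ≠ 0) :
    polarRadius D ((polarRadius D x ^ 2 / ‖x‖ ^ 2) • x) = polarRadius D x := by
  have := h.pos x hx
  have := norm_pos_iff.2 hx
  exact polarRadius_smul D (by positivity) x

theorem norm_quasiInversion {x : E n} (hx : x ≠ 0) :
    ‖(polarRadius D x ^ 2 / ‖x‖ ^ 2) • x‖ = polarRadius D x ^ 2 / ‖x‖ := by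
  have := norm_pos_iff.2 hx
  rw [norm_smul, norm_div, norm_pow, norm_pow, norm_norm, Real.norm_of_nonneg (h.pos x hx).le]
  field_simp

theorem quasiInversion_quasiInversion (x : OnePoint (E n)) :
    quasiInversion D (quasiInversion D x) = x := by
  induction x using OnePoint.rec with
  | infty => rw [quasiInversion_infty, quasiInversion_zero]
  | coe x =>
    rcases eq_or_ne x 0 with rfl | hx
    · rw [quasiInversion_zero, quasiInversion_infty]
    · have h1 := (h.pos x hx).ne'
      have h2 := (norm_pos_iff.2 hx).ne'
      rw [quasiInversion_coe hx, quasiInversion_coe (h.quasiInversion_smul_ne_zero hx),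
        h.polarRadius_quasiInversion hx, h.norm_quasiInversion hx, smul_smul]
      have : polarRadius D x ^ 2 / (polarRadius D x ^ 2 / ‖x‖) ^ 2 *
          (polarRadius D x ^ 2 / ‖x‖ ^ 2) = 1 := by field_simp
      rw [this, one_smul]

theorem weight_quasiInversion (x : OnePoint (E n)) :
    weight D (quasiInversion D x) = (weight D x)⁻¹ := by
  induction x using OnePoint.rec with
  | infty => rw [quasiInversion_infty, weight_zero, weight_infty, inv_one]
  | coe x =>
    rcases eq_or_ne x 0 with rfl | hx
    · rw [quasiInversion_zero, weight_zero, weight_infty, inv_one]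
    · have h1 := (h.pos x hx).ne'
      have h2 := (norm_pos_iff.2 hx).ne'
      rw [quasiInversion_coe hx, weight_coe (h.quasiInversion_smul_ne_zero hx), weight_coe hx,
        h.polarRadius_quasiInversion hx, h.norm_quasiInversion hx]
      field_simp

/-- Factor the map as contraction, inversion in the unit sphere, extension. The outer maps cost `L`
each, and the inversion produces the weights, since the contraction of `x` has norm `‖x‖ / r_x`. -/
theorem gap_quasiInversion_le_coe {x y : E n} (hx : x ≠ 0) (hy : y ≠ 0) :
    ‖(polarRadius D x ^ 2 / ‖x‖ ^ 2) • x - (polarRadius D y ^ 2 / ‖y‖ ^ 2) • y‖ ≤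
      L ^ 2 * (polarRadius D x / ‖x‖) * (polarRadius D y / ‖y‖) * ‖x - y‖ := by
  have hL := h.one_le
  have key : ∀ {x : E n}, x ≠ 0 → radialContraction D x ≠ 0 ∧
      ‖radialContraction D x‖ = ‖x‖ / polarRadius D x ∧
      (polarRadius D x ^ 2 / ‖x‖ ^ 2) • x = radialExtension D
        ((1 / ‖radialContraction D x‖) ^ 2 • radialContraction D x) := by
    intro x hx
    have h1 := h.pos x hx
    have h2 := norm_pos_iff.2 hx
    have hne : radialContraction D x ≠ 0 := smul_ne_zero (inv_ne_zero h1.ne') hx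
    have hnorm : ‖radialContraction D x‖ = ‖x‖ / polarRadius D x := by
      rw [radialContraction, norm_smul, norm_inv, Real.norm_of_nonneg h1.le]
      field_simp
    refine ⟨hne, hnorm, ?_⟩
    rw [radialExtension, hnorm, polarRadius_smul D (by positivity), radialContraction,
      polarRadius_smul D (by positivity), smul_smul, smul_smul]
    congr 1
    field_simp
  obtain ⟨hx1, hx2, hx3⟩ := key hx
  obtain ⟨hy1, hy2, hy3⟩ := key hy
  have h3 := dist_div_norm_sq_smul hx1 hy1 1
  rw [dist_eq_norm, dist_eq_norm] at h3
  have hpx := h.pos x hx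
  have hpy := h.pos y hy
  have hnx := norm_pos_iff.2 hx
  have hny := norm_pos_iff.2 hy
  rw [hx3, hy3]
  refine (h.extension_le _ _).trans ?_
  rw [h3, hx2, hy2]
  calc L * (1 ^ 2 / (‖x‖ / polarRadius D x * (‖y‖ / polarRadius D y)) *
        ‖radialContraction D x - radialContraction D y‖)
      ≤ L * (1 ^ 2 / (‖x‖ / polarRadius D x * (‖y‖ / polarRadius D y)) * (L * ‖x - y‖)) := by
        gcongr
        exact h.contraction_le _ _
    _ = _ := by field_simp

/-- The conventional weight `1` at `0` and `∞` is compatible with the gap convention: pairs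
involving these points need only `r_x ≤ L`, `1 ≤ L r_x` and `1 ≤ L`. -/
theorem gap_quasiInversion_le (x y : OnePoint (E n)) :
    gap (quasiInversion D x) (quasiInversion D y) ≤
      L ^ 2 * weight D x * weight D y * gap x y := by
  have hL := h.one_le
  have hL2 : 1 ≤ L ^ 2 := one_le_pow₀ hL
  have hinf : ∀ y : OnePoint (E n), gap (quasiInversion D ∞) (quasiInversion D y) ≤
      L ^ 2 * weight D ∞ * weight D y * gap ∞ y := by
    intro y
    induction y using OnePoint.rec with
    | infty => simp [quasiInversion_infty, gap]
    | coe y =>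
      rcases eq_or_ne y 0 with rfl | hy
      · simpa [quasiInversion_infty, quasiInversion_zero, weight_infty, weight_zero, gap]
          using hL2
      · have h1 := h.pos y hy
        have h2 := norm_pos_iff.2 hy
        rw [quasiInversion_infty, quasiInversion_coe hy, gap_coe, zero_sub, norm_neg,
          h.norm_quasiInversion hy, weight_infty, weight_coe hy]
        have h3 : polarRadius D y ≤ L ^ 2 := (h.polarRadius_le hy).trans (by nlinarith)
        simp only [gap, mul_one]
        rw [sq (polarRadius D y), mul_div_assoc]
        gcongr
  have hzero : ∀ y : OnePoint (E n), gap (quasiInversion D ((0 : E n) : OnePoint (E n)))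
      (quasiInversion D y) ≤ L ^ 2 * weight D ((0 : E n) : OnePoint (E n)) * weight D y *
        gap ((0 : E n) : OnePoint (E n)) y := by
    intro y
    induction y using OnePoint.rec with
    | infty =>
      simpa [quasiInversion_infty, quasiInversion_zero, weight_infty, weight_zero, gap]
          using hL2
    | coe y =>
      rcases eq_or_ne y 0 with rfl | hy
      · simp [quasiInversion_zero, gap]
      · have h1 := h.pos y hy
        have h2 := norm_pos_iff.2 hy
        rw [quasiInversion_zero, quasiInversion_coe hy, gap_coe, zero_sub, norm_neg,
          weight_zero, weight_coe hy]
        have h3 := h.one_le_mul_polarRadius hy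
        simp only [gap, mul_one]
        have : L ^ 2 * (polarRadius D y / ‖y‖) * ‖y‖ = L * (L * polarRadius D y) := by
          field_simp
        rw [this]
        nlinarith
  induction x using OnePoint.rec with
  | infty => exact hinf y
  | coe x =>
    rcases eq_or_ne x 0 with rfl | hx
    · exact hzero y
    induction y using OnePoint.rec with
    | infty =>
      rw [gap_comm, gap_comm (x : OnePoint (E n)), mul_right_comm (L ^ 2)]
      exact hinf x
    | coe y =>
      rcases eq_or_ne y 0 with rfl | hy
      · rw [gap_comm, gap_comm (x : OnePoint (E n)), mul_right_comm (L ^ 2)]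
        exact hzero x
      · rw [quasiInversion_coe hx, quasiInversion_coe hy, weight_coe hx, weight_coe hy, gap_coe,
          gap_coe]
        exact h.gap_quasiInversion_le_coe hx hy

/-- The upper bound at the image points, since the map is an involution that inverts weights. -/
theorem le_gap_quasiInversion (x y : OnePoint (E n)) :
    weight D x * weight D y * gap x y / L ^ 2 ≤ gap (quasiInversion D x) (quasiInversion D y) := by
  have h1 := h.gap_quasiInversion_le (quasiInversion D x) (quasiInversion D y)
  rw [h.quasiInversion_quasiInversion, h.quasiInversion_quasiInversion,
    h.weight_quasiInversion, h.weight_quasiInversion] at h1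
  have hL : 0 < L := one_pos.trans_le h.one_le
  have hx := h.weight_pos x
  have hy := h.weight_pos y
  rw [div_le_iff₀ (by positivity)]
  calc weight D x * weight D y * gap x y ≤ weight D x * weight D y * (L ^ 2 * (weight D x)⁻¹ *
        (weight D y)⁻¹ * gap (quasiInversion D x) (quasiInversion D y)) := by gcongr
    _ = _ := by field_simp

theorem inv_gap_quasiInversion_le (x y : OnePoint (E n)) :
    (gap (quasiInversion D x) (quasiInversion D y))⁻¹ ≤
      L ^ 2 / (weight D x * weight D y) * (gap x y)⁻¹ := by
  have hL : 0 < L := one_pos.trans_le h.one_le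
  have hx := h.weight_pos x
  have hy := h.weight_pos y
  -- When the gap vanishes so does its image, and both inverses are `0` by convention.
  rcases (gap_nonneg x y).eq_or_lt with h0 | h0
  · have h1 := h.gap_quasiInversion_le x y
    rw [← h0, mul_zero] at h1
    rw [← h0, le_antisymm h1 (gap_nonneg _ _)]
    simp
  · have h1 := inv_anti₀ (by positivity) (h.le_gap_quasiInversion x y)
    refine h1.trans_eq ?_
    field_simp

/-- Each of the four weights occurs once above and once below and cancels; each of the four gaps
contributes `L²`. -/
theorem absRatio_quasiInversion_le (a x b y : OnePoint (E n)) :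
    absRatio (quasiInversion D a) (quasiInversion D x) (quasiInversion D b) (quasiInversion D y) ≤
      L ^ 8 * absRatio a x b y := by
  have hL : 0 < L := one_pos.trans_le h.one_le
  have ha := h.weight_pos a
  have hb := h.weight_pos b
  have hx := h.weight_pos x
  have hy := h.weight_pos y
  unfold absRatio
  rw [div_eq_mul_inv, mul_inv, div_eq_mul_inv, mul_inv]
  calc _ ≤ (L ^ 2 * weight D a * weight D b * gap a b) *
        (L ^ 2 * weight D x * weight D y * gap x y) *
        ((L ^ 2 / (weight D a * weight D x) * (gap a x)⁻¹) *
          (L ^ 2 / (weight D b * weight D y) * (gap b y)⁻¹)) := by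
        have e1 := h.gap_quasiInversion_le a b
        have e2 := h.gap_quasiInversion_le x y
        have e3 := h.inv_gap_quasiInversion_le a x
        have e4 := h.inv_gap_quasiInversion_le b y
        have g1 := gap_nonneg (quasiInversion D a) (quasiInversion D b)
        have g2 := gap_nonneg (quasiInversion D x) (quasiInversion D y)
        have g3 := gap_nonneg (quasiInversion D a) (quasiInversion D x)
        have g4 := gap_nonneg (quasiInversion D b) (quasiInversion D y)
        have g1' := g1.trans e1
        have g2' := g2.trans e2
        have g3' := (inv_nonneg.2 g3).trans e3
        gcongr
    _ = _ := by
        have : ∀ A B X Y : ℝ, (L ^ 2 * weight D a * weight D b * A) *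
          (L ^ 2 * weight D x * weight D y * B) * ((L ^ 2 / (weight D a * weight D x) * X) *
          (L ^ 2 / (weight D b * weight D y) * Y)) = L ^ 8 * (A * B * (X * Y)) := by
          intro A B X Y
          field_simp
        exact this _ _ _ _

/-- Only three gaps occur, hence `L⁶`. The weights of `a` and `b` cancel, while that of `x` survives
squared and is later absorbed by the arc length element. -/
theorem ferrandRatio_quasiInversion_le (x a b : OnePoint (E n)) :
    gap (quasiInversion D a) (quasiInversion D b) / (gap (quasiInversion D x) (quasiInversion D a) *
      gap (quasiInversion D x) (quasiInversion D b)) ≤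
      L ^ 6 / weight D x ^ 2 * (gap a b / (gap x a * gap x b)) := by
  have hL : 0 < L := one_pos.trans_le h.one_le
  have ha := h.weight_pos a
  have hb := h.weight_pos b
  have hx := h.weight_pos x
  rw [div_eq_mul_inv, mul_inv, div_eq_mul_inv (gap a b), mul_inv]
  calc _ ≤ (L ^ 2 * weight D a * weight D b * gap a b) *
        ((L ^ 2 / (weight D x * weight D a) * (gap x a)⁻¹) *
          (L ^ 2 / (weight D x * weight D b) * (gap x b)⁻¹)) := by
        have e1 := h.gap_quasiInversion_le a b
        have e3 := h.inv_gap_quasiInversion_le x a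
        have e4 := h.inv_gap_quasiInversion_le x b
        have g1 := gap_nonneg (quasiInversion D a) (quasiInversion D b)
        have g3 := gap_nonneg (quasiInversion D x) (quasiInversion D a)
        have g4 := gap_nonneg (quasiInversion D x) (quasiInversion D b)
        have g1' := g1.trans e1
        have g3' := (inv_nonneg.2 g3).trans e3
        gcongr
    _ = _ := by
        have : ∀ A X Y : ℝ, (L ^ 2 * weight D a * weight D b * A) *
          ((L ^ 2 / (weight D x * weight D a) * X) * (L ^ 2 / (weight D x * weight D b) * Y)) =
          L ^ 6 / weight D x ^ 2 * (A * (X * Y)) := by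
          intro A X Y
          field_simp
        exact this _ _ _

end IsRadialBiLip

/-! ### The chordal metric -/

/-- The factor relating the chordal metric to the Euclidean one. -/
def chordalFactor : OnePoint (E n) → ℝ
  | ∞ => 1
  | OnePoint.some x => √(1 + ‖x‖ ^ 2)

theorem chordalFactor_pos (x : OnePoint (E n)) : 0 < chordalFactor x := by
  induction x using OnePoint.rec with
  | infty => exact one_pos
  | coe x => exact Real.sqrt_pos.2 (by positivity)

theorem chordal_eq (x y : OnePoint (E n)) :
    chordal x y = gap x y / (chordalFactor x * chordalFactor y) := by
  induction x using OnePoint.rec <;> induction y using OnePoint.rec <;>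
    simp [chordal, gap, chordalFactor]

namespace IsRadialBiLip

variable (h : IsRadialBiLip D L)

include h

/-- Both sides are square roots of affine functions of `r² / |x|²`, and `1 / L ≤ r ≤ L` compares
their coefficients. -/
theorem weight_mul_chordalFactor_le (x : OnePoint (E n)) :
    weight D x * chordalFactor x ≤ L ^ 2 * chordalFactor (quasiInversion D x) := by
  have hL := h.one_le
  have hL2 : 1 ≤ L ^ 2 := one_le_pow₀ hL
  induction x using OnePoint.rec with
  | infty => simpa [quasiInversion_infty, weight_infty, chordalFactor] using hL2
  | coe x =>
    rcases eq_or_ne x 0 with rfl | hx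
    · simpa [quasiInversion_zero, weight_zero, chordalFactor] using hL2
    · have h1 := h.pos x hx
      have h2 := norm_pos_iff.2 hx
      have h3 := h.polarRadius_le hx
      have h4 := h.one_le_mul_polarRadius hx
      rw [quasiInversion_coe hx, weight_coe hx]
      simp only [chordalFactor]
      rw [h.norm_quasiInversion hx]
      set r := polarRadius D x
      have e1 : r / ‖x‖ * √(1 + ‖x‖ ^ 2) = √(r ^ 2 / ‖x‖ ^ 2 + r ^ 2) := by
        rw [← Real.sqrt_sq (by positivity : 0 ≤ r / ‖x‖), ← Real.sqrt_mul (by positivity)]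
        congr 1
        field_simp
      have e2 : L ^ 2 * √(1 + (r ^ 2 / ‖x‖) ^ 2) =
          √(L ^ 4 + (L * r) ^ 2 * L ^ 2 * (r ^ 2 / ‖x‖ ^ 2)) := by
        conv_lhs => rw [← Real.sqrt_sq (by positivity : 0 ≤ L ^ 2)]
        rw [← Real.sqrt_mul (by positivity)]
        congr 1
        field_simp
      rw [e1, e2]
      refine Real.sqrt_le_sqrt ?_
      have e3 : r ^ 2 ≤ L ^ 4 := by
        calc r ^ 2 ≤ L ^ 2 := by gcongr
          _ ≤ L ^ 4 := pow_le_pow_right₀ hL (by norm_num)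
      have e4 : 1 ≤ (L * r) ^ 2 * L ^ 2 := one_le_mul_of_one_le_of_one_le (one_le_pow₀ h4) hL2
      have e5 : 0 ≤ r ^ 2 / ‖x‖ ^ 2 := by positivity
      nlinarith

/-- Ensures that rectifiable curves, including those through `∞`, have rectifiable images; the value
of the constant does not enter the final bound. -/
theorem chordal_quasiInversion_le (x y : OnePoint (E n)) :
    chordal (quasiInversion D x) (quasiInversion D y) ≤ L ^ 6 * chordal x y := by
  have hL : 0 < L := one_pos.trans_le h.one_le
  rw [chordal_eq, chordal_eq]
  have hx := h.weight_mul_chordalFactor_le x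
  have hy := h.weight_mul_chordalFactor_le y
  have c1 := chordalFactor_pos x
  have c2 := chordalFactor_pos y
  have c3 := chordalFactor_pos (quasiInversion D x)
  have c4 := chordalFactor_pos (quasiInversion D y)
  have w1 := h.weight_pos x
  have w2 := h.weight_pos y
  have hg := h.gap_quasiInversion_le x y
  have g0 := gap_nonneg x y
  rw [div_le_iff₀ (by positivity)]
  have hm := mul_le_mul hx hy (by positivity) (by positivity)
  calc _ ≤ _ := hg
    _ = L ^ 2 * gap x y / (chordalFactor x * chordalFactor y) *
        ((weight D x * chordalFactor x) * (weight D y * chordalFactor y)) := by field_simp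
    _ ≤ L ^ 2 * gap x y / (chordalFactor x * chordalFactor y) *
        ((L ^ 2 * chordalFactor (quasiInversion D x)) *
          (L ^ 2 * chordalFactor (quasiInversion D y))) := by gcongr
    _ = _ := by ring

/-! ### The quasi-inversion as a homeomorphism -/

theorem continuousAt_polarRadius {x : E n} (hx : x ≠ 0) : ContinuousAt (polarRadius D) x := by
  have hc : Continuous (radialExtension D) :=
    (LipschitzWith.of_dist_le_mul (K := L.toNNReal) fun x y => by
      rw [dist_eq_norm, dist_eq_norm, Real.coe_toNNReal _ (zero_le_one.trans h.one_le)]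
      exact h.extension_le y x).continuous
  have h1 : ContinuousAt (fun y => ‖radialExtension D y‖ / ‖y‖) x :=
    hc.norm.continuousAt.div continuous_norm.continuousAt (norm_ne_zero_iff.2 hx)
  refine h1.congr ?_
  filter_upwards [isOpen_ne.mem_nhds hx] with y hy
  rw [radialExtension, norm_smul, Real.norm_of_nonneg (h.pos y hy).le,
    mul_div_cancel_right₀ _ (norm_ne_zero_iff.2 hy)]

/-- At `∞` and `0` this is `L⁻² / |x| ≤ |f x| ≤ L² / |x|`; elsewhere it is continuity of the polar
radius. -/
theorem continuous_quasiInversion : Continuous (quasiInversion D) := by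
  have hL : 0 < L := one_pos.trans_le h.one_le
  refine continuous_iff_continuousAt.2 fun x => ?_
  induction x using OnePoint.rec with
  | infty =>
    rw [OnePoint.continuousAt_infty', coclosedCompact_eq_cocompact, quasiInversion_infty]
    have h1 : Tendsto (fun x : E n => (polarRadius D x ^ 2 / ‖x‖ ^ 2) • x) (cocompact (E n))
        (𝓝 0) := by
      have h2 : Tendsto (fun x : E n => L ^ 2 * ‖x‖⁻¹) (cocompact (E n)) (𝓝 (L ^ 2 * 0)) :=
        (tendsto_inv_atTop_zero.comp (tendsto_norm_cocompact_atTop)).const_mul _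
      rw [mul_zero] at h2
      refine squeeze_zero_norm (fun x => ?_) h2
      rcases eq_or_ne x 0 with rfl | hx
      · simp
      · rw [h.norm_quasiInversion hx, div_eq_mul_inv]
        have := h.polarRadius_le hx
        have := h.pos x hx
        gcongr
    refine ((OnePoint.continuous_coe.tendsto _).comp h1).congr' ?_
    have : ∀ᶠ x : E n in cocompact (E n), x ≠ 0 :=
      (tendsto_norm_cocompact_atTop.eventually_gt_atTop 0).mono fun x hx => norm_pos_iff.1 hx
    filter_upwards [this] with x hx using (quasiInversion_coe hx).symm
  | coe x =>
    rw [OnePoint.continuousAt_coe]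
    rcases eq_or_ne x 0 with rfl | hx
    · rw [continuousAt_iff_punctured_nhds]
      simp only [Function.comp]
      rw [quasiInversion_zero]
      have h1 : Tendsto (fun x : E n => (polarRadius D x ^ 2 / ‖x‖ ^ 2) • x) (𝓝[≠] 0)
          (cocompact (E n)) := by
        rw [← Metric.cobounded_eq_cocompact, ← comap_norm_atTop, tendsto_comap_iff]
        · have h2 : Tendsto (fun x : E n => (L ^ 2)⁻¹ * ‖x‖⁻¹) (𝓝[≠] 0) atTop :=
            (tendsto_inv_nhdsGT_zero.comp tendsto_norm_nhdsNE_zero).const_mul_atTop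
              (by positivity)
          refine tendsto_atTop_mono' _ ?_ h2
          filter_upwards [self_mem_nhdsWithin] with x hx
          simp only [Function.comp]
          rw [h.norm_quasiInversion hx, div_eq_mul_inv]
          gcongr
          rw [inv_le_iff_one_le_mul₀ (by positivity), mul_comm, ← mul_pow]
          exact one_le_pow₀ (h.one_le_mul_polarRadius hx)
      rw [← coclosedCompact_eq_cocompact] at h1
      refine (OnePoint.tendsto_coe_infty.comp h1).congr' ?_
      filter_upwards [self_mem_nhdsWithin] with x hx using (quasiInversion_coe hx).symm
    · have h1 : ContinuousAt (fun x : E n => (polarRadius D x ^ 2 / ‖x‖ ^ 2) • x) x := by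
        have := h.continuousAt_polarRadius hx
        have : ‖x‖ ^ 2 ≠ 0 := pow_ne_zero _ (norm_ne_zero_iff.2 hx)
        fun_prop (disch := assumption)
      refine (OnePoint.continuous_coe.continuousAt.comp h1).congr ?_
      filter_upwards [isOpen_ne.mem_nhds hx] with y hy using (quasiInversion_coe hy).symm

end IsRadialBiLip

/-- The quasi-inversion as a homeomorphism of the compactified space. -/
def quasiInversionHomeo (h : IsRadialBiLip D L) : OnePoint (E n) ≃ₜ OnePoint (E n) where
  toFun := quasiInversion D
  invFun := quasiInversion D
  left_inv := h.quasiInversion_quasiInversion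
  right_inv := h.quasiInversion_quasiInversion
  continuous_toFun := h.continuous_quasiInversion
  continuous_invFun := h.continuous_quasiInversion

theorem IsRadialBiLip.frontier_image (h : IsRadialBiLip D L) (G : Set (OnePoint (E n))) :
    frontier (quasiInversion D '' G) = quasiInversion D '' frontier G :=
  ((quasiInversionHomeo h).image_frontier G).symm

theorem IsRadialBiLip.image_image (h : IsRadialBiLip D L) (G : Set (OnePoint (E n))) :
    quasiInversion D '' (quasiInversion D '' G) = G := by
  rw [Set.image_image]
  simp [h.quasiInversion_quasiInversion]

end Distortion

/-! ### The Möbius metric under the quasi-inversion -/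

/-- Bernoulli's inequality `1 + C s ≤ (1 + s) ^ C` after taking logarithms; the value `⊤` is treated
separately. -/
theorem log_one_add_toENNReal_le {C : ℝ} (hC : 1 ≤ C) {s t : ℝ≥0∞}
    (h : t ≤ ENNReal.ofReal C * s) :
    (ENNReal.log (1 + t)).toENNReal ≤ ENNReal.ofReal C * (ENNReal.log (1 + s)).toENNReal := by
  have hC0 : 0 < C := one_pos.trans_le hC
  have h1 : 1 + t ≤ (1 + s) ^ C := by
    refine (add_le_add_right h 1).trans ?_
    rcases eq_or_ne s ⊤ with rfl | hs
    · simp [ENNReal.top_rpow_of_pos hC0]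
    · lift s to NNReal using hs
      have h2 := one_add_mul_self_le_rpow_one_add (s := (s : ℝ)) (by
        linarith [NNReal.coe_nonneg s]) hC
      have h3 : ENNReal.ofReal (1 + C * s) ≤ ENNReal.ofReal ((1 + s) ^ C) :=
        ENNReal.ofReal_le_ofReal h2
      rw [← ENNReal.ofReal_rpow_of_pos (by positivity), ENNReal.ofReal_add zero_le_one
        (by positivity), ENNReal.ofReal_add zero_le_one (by positivity),
        ENNReal.ofReal_mul hC0.le] at h3
      simpa using h3
  have h2 : ENNReal.log (1 + t) ≤ (C : EReal) * ENNReal.log (1 + s) := by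
    rw [← ENNReal.log_rpow]
    exact ENNReal.log_le_log h1
  refine (EReal.toENNReal_le_toENNReal h2).trans_eq ?_
  rw [EReal.toENNReal_mul (by exact_mod_cast hC0.le), EReal.real_coe_toENNReal]

section Metrics

variable {n : ℕ} {D : Set (E n)} {L : ℝ}

theorem IsRadialBiLip.mobiusDist_le (h : IsRadialBiLip D L) (G : Set (OnePoint (E n)))
    (x y : OnePoint (E n)) :
    mobiusDist (quasiInversion D '' G) (quasiInversion D x) (quasiInversion D y) ≤
      ENNReal.ofReal (L ^ 8) * mobiusDist G x y := by
  refine log_one_add_toENNReal_le (one_le_pow₀ h.one_le) ?_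
  rw [h.frontier_image]
  refine iSup₂_le ?_
  rintro _ ⟨a, ha, rfl⟩
  refine iSup₂_le ?_
  rintro _ ⟨b, hb, rfl⟩
  have hL : 0 ≤ L ^ 8 := pow_nonneg (zero_le_one.trans h.one_le) 8
  refine (ENNReal.ofReal_le_ofReal (h.absRatio_quasiInversion_le a x b y)).trans ?_
  rw [ENNReal.ofReal_mul hL]
  gcongr
  exact (le_iSup₂ (f := fun b (_ : b ∈ frontier G) => ENNReal.ofReal (absRatio a x b y)) b hb).trans
    (le_iSup₂ (f := fun a (_ : a ∈ frontier G) =>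
      ⨆ b ∈ frontier G, ENNReal.ofReal (absRatio a x b y)) a ha)

/-! ### Ferrand's metric under the quasi-inversion -/

theorem IsRadialBiLip.ferrandDensity_le (h : IsRadialBiLip D L) (G : Set (OnePoint (E n)))
    {x y : E n} (hxy : quasiInversion D (x : OnePoint (E n)) = (y : OnePoint (E n))) :
    ferrandDensity (quasiInversion D '' G) y ≤
      ENNReal.ofReal (L ^ 6 / weight D (x : OnePoint (E n)) ^ 2) * ferrandDensity G x := by
  unfold ferrandDensity
  rw [h.frontier_image, ← hxy]
  refine iSup₂_le ?_
  rintro _ ⟨a, ha, rfl⟩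
  refine iSup₂_le ?_
  rintro _ ⟨b, hb, rfl⟩
  have hL : 0 ≤ L := zero_le_one.trans h.one_le
  refine (ENNReal.ofReal_le_ofReal (h.ferrandRatio_quasiInversion_le x a b)).trans ?_
  rw [ENNReal.ofReal_mul (by positivity)]
  gcongr
  exact (le_iSup₂ (f := fun b (_ : b ∈ frontier G) => ENNReal.ofReal
      (gap a b / (gap (x : OnePoint (E n)) a * gap (x : OnePoint (E n)) b))) b hb).trans
    (le_iSup₂ (f := fun a (_ : a ∈ frontier G) => ⨆ b ∈ frontier G, ENNReal.ofReal
      (gap a b / (gap (x : OnePoint (E n)) a * gap (x : OnePoint (E n)) b))) a ha)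

/-! ### Derivatives of chordally Lipschitz curves and the line integral -/

/-- The interior times at which a curve is finite. -/
def finiteTimes (γ : ℝ → OnePoint (E n)) : Set ℝ := {t | t ∈ Ioo (0 : ℝ) 1 ∧ γ t ≠ OnePoint.infty}

theorem coe_finitePart {x : OnePoint (E n)} (hx : x ≠ OnePoint.infty) :
    (finitePart x : OnePoint (E n)) = x := by
  induction x using OnePoint.rec with
  | infty => exact absurd rfl hx
  | coe x => rfl

/-- Dropping the endpoints, a null set, makes the domain of integration open for chordally Lipschitz
curves, so that derivatives can be taken there. -/
theorem lineIntegral_eq (w : E n → ℝ≥0∞) (γ : ℝ → OnePoint (E n)) :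
    lineIntegral w γ = ∫⁻ t in finiteTimes γ,
      w (finitePart (γ t)) * ‖deriv (fun s => finitePart (γ s)) t‖ₑ := by
  refine setLIntegral_congr ?_
  have h0 : ∀ᵐ t : ℝ, t ≠ 0 := by simp [ae_iff]
  have h1 : ∀ᵐ t : ℝ, t ≠ 1 := by simp [ae_iff]
  filter_upwards [h0, h1] with t ht0 ht1
  exact propext ⟨fun h => ⟨⟨lt_of_le_of_ne h.1.1 ht0.symm, lt_of_le_of_ne h.1.2 ht1⟩, h.2⟩,
    fun h => ⟨⟨h.1.1.le, h.1.2.le⟩, h.2⟩⟩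

/-- A curve that is Lipschitz for the chordal metric is locally Lipschitz for the Euclidean one
at the times at which it is finite. -/
theorem exists_lipschitzOnWith_finitePart {γ : ℝ → OnePoint (E n)} {K : ℝ}
    (hγ : ∀ s ∈ Icc (0 : ℝ) 1, ∀ t ∈ Icc (0 : ℝ) 1, chordal (γ s) (γ t) ≤ K * |s - t|)
    {t : ℝ} (ht : t ∈ finiteTimes γ) :
    ∃ U ∈ 𝓝 t, U ⊆ finiteTimes γ ∧ ∃ C, LipschitzOnWith C (fun s => finitePart (γ s)) U := by
  obtain ⟨ht01, hfin⟩ := ht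
  set x := finitePart (γ t) with hx
  have hγt : γ t = (x : OnePoint (E n)) := (coe_finitePart hfin).symm
  set B := √(1 + ‖x‖ ^ 2) with hB
  have hB0 : 0 < B := Real.sqrt_pos.2 (by positivity)
  -- The chordal distance from `x` to `∞` is `1 / B`. Staying within half of it excludes `∞` and
  -- forces `‖y‖ ≤ 2 * ‖x‖ + 1`.
  have hsmall : ∀ᶠ s in 𝓝 t, K * |s - t| * B < 1 / 2 := by
    have : Continuous fun s => K * |s - t| * B := by fun_prop
    exact (this.tendsto t).eventually_lt_const (by simp)
  set U := {s | s ∈ Ioo (0 : ℝ) 1 ∧ K * |s - t| * B < 1 / 2} with hU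
  have hUn : U ∈ 𝓝 t := (Ioo_mem_nhds ht01.1 ht01.2 |> fun h => inter_mem h hsmall)
  have hcf : chordalFactor (x : OnePoint (E n)) = B := rfl
  have hbd : ∀ s ∈ U, γ s ≠ OnePoint.infty ∧ chordalFactor (γ s) ≤ √(1 + (2 * ‖x‖ + 1) ^ 2) := by
    rintro s ⟨hs, hsK⟩
    have h1 := hγ s (Ioo_subset_Icc_self hs) t (Ioo_subset_Icc_self ht01)
    rw [chordal_eq, hγt, hcf, div_le_iff₀ (mul_pos (chordalFactor_pos _) hB0)] at h1
    generalize γ s = z at h1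
    induction z using OnePoint.rec with
    | infty =>
      simp only [gap, chordalFactor] at h1
      linarith
    | coe y =>
      refine ⟨OnePoint.coe_ne_infty y, ?_⟩
      rw [gap_coe] at h1
      simp only [chordalFactor] at h1 ⊢
      have h2 : √(1 + ‖y‖ ^ 2) ≤ 1 + ‖y‖ :=
        Real.sqrt_le_iff.2 ⟨by positivity, by nlinarith [norm_nonneg y]⟩
      have h3 : 0 ≤ √(1 + ‖y‖ ^ 2) := Real.sqrt_nonneg _
      have h4 := norm_sub_norm_le y x
      have h5 : ‖y‖ ≤ 2 * ‖x‖ + 1 := by nlinarith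
      gcongr
  set M := √(1 + (2 * ‖x‖ + 1) ^ 2)
  refine ⟨U, hUn, fun s hs => ⟨hs.1, (hbd s hs).1⟩, (|K| * M ^ 2).toNNReal,
    LipschitzOnWith.of_dist_le_mul fun s hs s' hs' => ?_⟩
  have h1 := hγ s (Ioo_subset_Icc_self hs.1) s' (Ioo_subset_Icc_self hs'.1)
  obtain ⟨f1, b1⟩ := hbd s hs
  obtain ⟨f2, b2⟩ := hbd s' hs'
  have p1 := chordalFactor_pos (γ s)
  have p2 := chordalFactor_pos (γ s')
  rw [chordal_eq, div_le_iff₀ (mul_pos p1 p2)] at h1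
  have hM : 0 ≤ M := Real.sqrt_nonneg _
  have hgap : gap (γ s) (γ s') = ‖finitePart (γ s) - finitePart (γ s')‖ := by
    rw [← gap_coe, coe_finitePart f1, coe_finitePart f2]
  rw [Real.coe_toNNReal _ (by positivity), dist_eq_norm, ← hgap, Real.dist_eq]
  calc gap (γ s) (γ s') ≤ K * |s - s'| * (chordalFactor (γ s) * chordalFactor (γ s')) := h1
    _ ≤ |K| * |s - s'| * (M * M) := by gcongr; exact le_abs_self K
    _ = |K| * M ^ 2 * |s - s'| := by ring

theorem isOpen_finiteTimes {γ : ℝ → OnePoint (E n)} {K : ℝ}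
    (hγ : ∀ s ∈ Icc (0 : ℝ) 1, ∀ t ∈ Icc (0 : ℝ) 1, chordal (γ s) (γ t) ≤ K * |s - t|) :
    IsOpen (finiteTimes γ) := by
  refine isOpen_iff_mem_nhds.2 fun t ht => ?_
  obtain ⟨U, hU, hUS, _⟩ := exists_lipschitzOnWith_finitePart hγ ht
  exact mem_of_superset hU hUS

theorem ae_differentiableAt_finitePart {γ : ℝ → OnePoint (E n)} {K : ℝ}
    (hγ : ∀ s ∈ Icc (0 : ℝ) 1, ∀ t ∈ Icc (0 : ℝ) 1, chordal (γ s) (γ t) ≤ K * |s - t|) :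
    ∀ᵐ t : ℝ, t ∈ finiteTimes γ → DifferentiableAt ℝ (fun s => finitePart (γ s)) t := by
  rw [ae_iff]
  refine measure_null_of_locally_null _ fun t ht => ?_
  simp only [mem_ofPred_eq, Classical.not_imp] at ht
  obtain ⟨U, hU, _, C, hC⟩ := exists_lipschitzOnWith_finitePart hγ ht.1
  obtain ⟨V, hVU, hVo, hVt⟩ := mem_nhds_iff.1 hU
  refine ⟨{s | ¬(s ∈ finiteTimes γ → DifferentiableAt ℝ (fun s => finitePart (γ s)) s)} ∩ V,
    inter_mem_nhdsWithin _ (hVo.mem_nhds hVt), ?_⟩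
  have h1 := (hC.mono hVU).ae_differentiableWithinAt_of_mem_real
  refine measure_mono_null ?_ (ae_iff.1 h1)
  rintro s ⟨hs, hsV⟩ hd
  exact hs fun _ => (hd hsV).differentiableAt (hVo.mem_nhds hsV)

/-- Isolated zeros form a null set, and at an accumulation point of zeros a derivative can only be
`0`. This disposes of the times when a curve is at `∞` and its image at the origin. -/
theorem ae_deriv_eq_zero_of_eq_zero {W : Type*} [NormedAddCommGroup W] [NormedSpace ℝ W]
    (g : ℝ → W) : ∀ᵐ t : ℝ, g t = 0 → deriv g t = 0 := by
  set A := {t | g t = 0} with hA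
  have h1 : ∀ᵐ t : ℝ, t ∈ A → AccPt t (𝓟 A) := by
    rw [ae_iff]
    refine measure_null_of_locally_null _ fun t ht => ?_
    simp only [mem_ofPred_eq, Classical.not_imp, accPt_iff_frequently, not_frequently] at ht
    obtain ⟨V, hV, hV'⟩ := eventually_iff_exists_mem.1 ht.2
    refine ⟨_, inter_mem_nhdsWithin _ hV, measure_mono_null ?_ (measure_singleton t)⟩
    rintro s ⟨hs, hsV⟩
    simp only [mem_ofPred_eq, Classical.not_imp] at hs
    by_contra hst
    exact hV' s hsV ⟨hst, hs.1⟩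
  filter_upwards [h1] with t ht hgt
  by_cases hd : DifferentiableAt ℝ g t
  · have hu : UniqueDiffWithinAt ℝ A t := uniqueDiffWithinAt_iff_accPt.2 (ht hgt)
    have h2 : HasDerivWithinAt g 0 A t :=
      (hasDerivWithinAt_const t A (0 : W)).congr (fun s hs => hs) hgt
    exact hu.eq_deriv _ hd.hasDerivAt.hasDerivWithinAt h2
  · exact deriv_zero_of_not_differentiableAt hd

theorem norm_deriv_le_of_eventually_le {W : Type*} [NormedAddCommGroup W] [NormedSpace ℝ W]
    {g g' : ℝ → W} {v v' : W} {t : ℝ} (hg : HasDerivAt g v t) (hg' : HasDerivAt g' v' t)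
    {k : ℝ → ℝ} {k₀ : ℝ} (hk : Tendsto k (𝓝 t) (𝓝 k₀))
    (h : ∀ᶠ s in 𝓝 t, ‖g' s - g' t‖ ≤ k s * ‖g s - g t‖) : ‖v'‖ ≤ k₀ * ‖v‖ := by
  have h1 := (hasDerivAt_iff_tendsto_slope.1 hg).norm
  have h2 := (hasDerivAt_iff_tendsto_slope.1 hg').norm
  refine le_of_tendsto_of_tendsto h2 ((hk.mono_left nhdsWithin_le_nhds).mul h1) ?_
  filter_upwards [h.filter_mono nhdsWithin_le_nhds] with s hs
  simp only [slope, vsub_eq_sub, norm_smul]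
  calc ‖(s - t)⁻¹‖ * ‖g' s - g' t‖ ≤ ‖(s - t)⁻¹‖ * (k s * ‖g s - g t‖) := by gcongr
    _ = _ := by ring

theorem IsRadialBiLip.norm_deriv_quasiInversion_le (h : IsRadialBiLip D L)
    {γ : ℝ → OnePoint (E n)} {t : ℝ} (hfin : ∀ᶠ s in 𝓝 t, γ s ≠ OnePoint.infty)
    (hfin' : quasiInversion D (γ t) ≠ OnePoint.infty)
    (hd : DifferentiableAt ℝ (fun s => finitePart (γ s)) t) :
    ‖deriv (fun s => finitePart (quasiInversion D (γ s))) t‖ ≤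
      L ^ 2 * weight D (γ t) ^ 2 * ‖deriv (fun s => finitePart (γ s)) t‖ := by
  -- Where the image is not differentiable, `deriv` has the value `0` and the bound is trivial.
  by_cases hd' : DifferentiableAt ℝ (fun s => finitePart (quasiInversion D (γ s))) t
  swap
  · rw [deriv_zero_of_not_differentiableAt hd', norm_zero]
    positivity
  have hx0 : finitePart (γ t) ≠ 0 := by
    intro h0
    refine hfin' ?_
    rw [← coe_finitePart hfin.self_of_nhds, h0, quasiInversion_zero]
  have hne : ∀ᶠ s in 𝓝 t, finitePart (γ s) ≠ 0 := hd.continuousAt.eventually_ne hx0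
  set ρ := polarRadius D
  refine norm_deriv_le_of_eventually_le hd.hasDerivAt hd'.hasDerivAt
    (k := fun s => L ^ 2 * (ρ (finitePart (γ s)) / ‖finitePart (γ s)‖) *
      (ρ (finitePart (γ t)) / ‖finitePart (γ t)‖)) ?_ ?_
  · have h1 : ContinuousAt (fun s => ρ (finitePart (γ s))) t :=
      (h.continuousAt_polarRadius hx0).comp (f := fun s => finitePart (γ s)) hd.continuousAt
    have h2 : ContinuousAt (fun s => ρ (finitePart (γ s)) / ‖finitePart (γ s)‖) t :=
      h1.div hd.continuousAt.norm (norm_ne_zero_iff.2 hx0)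
    have h3 : weight D (γ t) = ρ (finitePart (γ t)) / ‖finitePart (γ t)‖ := by
      conv_lhs => rw [← coe_finitePart hfin.self_of_nhds]
      exact weight_coe hx0
    rw [h3, sq (ρ _ / _), ← mul_assoc]
    exact (h2.tendsto.const_mul _).mul_const _
  · filter_upwards [hfin, hne] with s hs hs0
    have e : ∀ {s}, γ s ≠ OnePoint.infty → finitePart (γ s) ≠ 0 → finitePart (quasiInversion D (γ s)) =
        (ρ (finitePart (γ s)) ^ 2 / ‖finitePart (γ s)‖ ^ 2) • finitePart (γ s) := by
      intro s hs hs0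
      conv_lhs => rw [← coe_finitePart hs, quasiInversion_coe hs0]
      rfl
    rw [e hs hs0, e hfin.self_of_nhds hx0]
    exact h.gap_quasiInversion_le_coe hs0 hx0

theorem IsRadialBiLip.lineIntegral_le (h : IsRadialBiLip D L) (G : Set (OnePoint (E n)))
    {γ : ℝ → OnePoint (E n)} {K : ℝ}
    (hγ : ∀ s ∈ Icc (0 : ℝ) 1, ∀ t ∈ Icc (0 : ℝ) 1, chordal (γ s) (γ t) ≤ K * |s - t|) :
    lineIntegral (ferrandDensity (quasiInversion D '' G)) (fun t => quasiInversion D (γ t)) ≤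
      ENNReal.ofReal (L ^ 8) * lineIntegral (ferrandDensity G) γ := by
  have hL : 0 < L := one_pos.trans_le h.one_le
  have hγ' : ∀ s ∈ Icc (0 : ℝ) 1, ∀ t ∈ Icc (0 : ℝ) 1,
      chordal (quasiInversion D (γ s)) (quasiInversion D (γ t)) ≤ (L ^ 6 * K) * |s - t| := by
    intro s hs t ht
    refine (h.chordal_quasiInversion_le _ _).trans ?_
    rw [mul_assoc]
    gcongr
    exact hγ s hs t ht
  have hS := isOpen_finiteTimes hγ
  have hS' := isOpen_finiteTimes hγ'
  -- The finite times of the image may include times when `γ` is at `∞`, so the integrals are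
  -- compared through an indicator instead of an inclusion of domains.
  rw [lineIntegral_eq, lineIntegral_eq, ← lintegral_indicator hS.measurableSet,
    ← lintegral_const_mul' _ _ ENNReal.ofReal_ne_top]
  refine (setLIntegral_mono_ae' hS'.measurableSet ?_).trans (setLIntegral_le_lintegral _ _)
  filter_upwards [ae_differentiableAt_finitePart hγ,
    ae_deriv_eq_zero_of_eq_zero fun s => finitePart (quasiInversion D (γ s))] with t ht1 ht2 ht
  by_cases hfin : γ t = OnePoint.infty
  · have h0 : deriv (fun s => finitePart (quasiInversion D (γ s))) t = 0 :=
      ht2 (by rw [hfin, quasiInversion_infty]; rfl)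
    rw [h0]
    simp
  have htS : t ∈ finiteTimes γ := ⟨ht.1, hfin⟩
  rw [indicator_of_mem htS]
  have hd := ht1 htS
  have h3 := h.norm_deriv_quasiInversion_le (eventually_of_mem (hS.mem_nhds htS) fun s hs => hs.2)
    ht.2 hd
  have h4 := h.ferrandDensity_le G (x := finitePart (γ t))
    (y := finitePart (quasiInversion D (γ t))) (by
      rw [coe_finitePart hfin, coe_finitePart ht.2])
  rw [coe_finitePart hfin] at h4
  have hw := h.weight_pos (γ t)
  have h5 : ‖deriv (fun s => finitePart (quasiInversion D (γ s))) t‖ₑ ≤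
      ENNReal.ofReal (L ^ 2 * weight D (γ t) ^ 2) * ‖deriv (fun s => finitePart (γ s)) t‖ₑ := by
    rw [← ofReal_norm, ← ofReal_norm, ← ENNReal.ofReal_mul (by positivity)]
    exact ENNReal.ofReal_le_ofReal h3
  refine (mul_le_mul' h4 h5).trans_eq ?_
  rw [mul_mul_mul_comm, ← ENNReal.ofReal_mul (by positivity)]
  congr 2
  field_simp

theorem IsRadialBiLip.ferrandDist_le (h : IsRadialBiLip D L) (G : Set (OnePoint (E n)))
    (x y : OnePoint (E n)) :
    ferrandDist (quasiInversion D '' G) (quasiInversion D x) (quasiInversion D y) ≤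
      ENNReal.ofReal (L ^ 8) * ferrandDist G x y := by
  have hL : 0 < L := one_pos.trans_le h.one_le
  have hC0 : ENNReal.ofReal (L ^ 8) ≠ 0 := (ENNReal.ofReal_pos.2 (by positivity)).ne'
  rw [← ENNReal.div_le_iff' hC0 ENNReal.ofReal_ne_top]
  refine le_iInf₂ fun γ hγ => ?_
  rw [ENNReal.div_le_iff' hC0 ENNReal.ofReal_ne_top]
  obtain ⟨K, hK⟩ := hγ.lipschitz
  refine (iInf₂_le (fun t => quasiInversion D (γ t)) ?_).trans (h.lineIntegral_le G hK)
  refine ⟨⟨L ^ 6 * K, fun s hs t ht => ?_⟩, fun t ht => mem_image_of_mem _ (hγ.mem t ht), ?_, ?_⟩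
  · refine (h.chordal_quasiInversion_le _ _).trans ?_
    rw [mul_assoc]
    gcongr
    exact hK s hs t ht
  · exact congrArg _ hγ.source
  · exact congrArg _ hγ.target

theorem IsRadialBiLip.quasiInversionIsBiLipschitz (h : IsRadialBiLip D L) (G : Set (E n)) :
    QuasiInversionIsBiLipschitz D G (L ^ 8) := by
  have hemb : IsEmbedding ((toExt G).domRestrict (quasiInversion D)) :=
    (quasiInversionHomeo h).isEmbedding.comp IsEmbedding.subtypeVal
  -- By involutivity the lower bound for `G` is the upper bound for the image of `G`.
  have hlow : ∀ d : Set (OnePoint (E n)) → OnePoint (E n) → OnePoint (E n) → ℝ≥0∞,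
      (∀ G x y, d (quasiInversion D '' G) (quasiInversion D x) (quasiInversion D y) ≤
        ENNReal.ofReal (L ^ 8) * d G x y) → ∀ G x y, d G x y / ENNReal.ofReal (L ^ 8) ≤
        d (quasiInversion D '' G) (quasiInversion D x) (quasiInversion D y) := by
    intro d hd G x y
    have := hd (quasiInversion D '' G) (quasiInversion D x) (quasiInversion D y)
    rw [h.image_image, h.quasiInversion_quasiInversion, h.quasiInversion_quasiInversion] at this
    exact ENNReal.div_le_of_le_mul' this
  exact ⟨⟨hemb, fun x _ y _ => hlow _ h.mobiusDist_le _ x y, fun x _ y _ => h.mobiusDist_le _ x y⟩,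
    ⟨hemb, fun x _ y _ => hlow _ h.ferrandDist_le _ x y, fun x _ y _ => h.ferrandDist_le _ x y⟩⟩

end Metrics

/-! ### Lipschitz bounds from almost everywhere bounds on the derivative -/

/-- By Fubini, for almost every `z` the segment from `z` to `z + v` meets the exceptional set in a
null set, so integrating along it gives the bound. Full measure sets are dense, and continuity
reaches every `z`. -/
theorem norm_sub_le_of_ae_norm_fderiv_le {V W : Type*} [NormedAddCommGroup V] [NormedSpace ℝ V]
    [FiniteDimensional ℝ V] [MeasurableSpace V] [BorelSpace V] {μ : Measure V}
    [μ.IsAddHaarMeasure] [NormedAddCommGroup W] [InnerProductSpace ℝ W] {f : V → W} {C : NNReal}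
    (hf : LipschitzWith C f) {ε : ℝ} (h : ∀ᵐ x ∂μ, DifferentiableAt ℝ f x ∧ ‖fderiv ℝ f x‖ ≤ ε)
    (x y : V) : ‖f y - f x‖ ≤ ε * ‖y - x‖ := by
  obtain ⟨N, hN, hNm, hN0⟩ := exists_measurable_superset_of_null (ae_iff.1 h)
  set v := y - x with hv
  have h1 : ∀ᵐ s : ℝ, ∀ᵐ z ∂μ, z + s • v ∉ N := by
    refine Eventually.of_forall fun s => ?_
    have : ∀ᵐ z ∂μ, z ∉ N := measure_eq_zero_iff_ae_notMem.1 hN0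
    exact (measurePreserving_add_right μ (s • v)).quasiMeasurePreserving.ae this
  have h2 : ∀ᵐ z ∂μ, ∀ᵐ s : ℝ, z + s • v ∉ N := by
    refine (Measure.ae_ae_comm (p := fun z (s : ℝ) => z + s • v ∉ N) ?_).2 h1
    have : Continuous fun p : V × ℝ => p.1 + p.2 • v := by fun_prop
    exact (hNm.preimage this.measurable).compl
  have h3 : ∀ᵐ z ∂μ, ‖f (z + v) - f z‖ ≤ ε * ‖v‖ := by
    filter_upwards [h2] with z hz
    set e := f (z + v) - f z with he
    -- Pairing with the total increment `e` reduces to a scalar absolutely continuous function whose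
    -- increment over the unit interval is `‖e‖ ^ 2`.
    let u : ℝ → ℝ := fun s => inner ℝ e (f (z + s • v))
    have hl : LipschitzWith (‖innerSL ℝ e‖₊ * (C * ‖v‖₊)) u := by
      refine (innerSL ℝ e).lipschitz.comp (hf.comp ?_)
      refine LipschitzWith.of_dist_le_mul fun s t => ?_
      rw [dist_add_left, dist_eq_norm, ← sub_smul, norm_smul, dist_eq_norm, mul_comm]
      rfl
    have hint := (hl.lipschitzOnWith (s := uIcc (0 : ℝ) 1)).absolutelyContinuousOnInterval
      |>.integral_deriv_eq_sub
    have hu : u 1 - u 0 = ‖e‖ ^ 2 := by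
      simp only [u]
      rw [← inner_sub_right, one_smul, zero_smul, add_zero, ← he, real_inner_self_eq_norm_sq]
    have hb : ‖∫ s in (0 : ℝ)..1, deriv u s‖ ≤ (‖e‖ * (ε * ‖v‖)) * |1 - 0| := by
      refine intervalIntegral.norm_integral_le_of_norm_le_const_ae ?_
      filter_upwards [hz] with s hs _
      have hs' : DifferentiableAt ℝ f (z + s • v) ∧ ‖fderiv ℝ f (z + s • v)‖ ≤ ε := by
        by_contra hcon
        exact hs (hN hcon)
      have hd1 : HasDerivAt (fun s : ℝ => z + s • v) v s := by
        simpa using ((hasDerivAt_id s).smul_const v).const_add z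
      have hd2 := hs'.1.hasFDerivAt.comp_hasDerivAt s hd1
      have hd3 : HasDerivAt u (innerSL ℝ e (fderiv ℝ f (z + s • v) v)) s :=
        (innerSL ℝ e).hasFDerivAt.comp_hasDerivAt s hd2
      rw [hd3.deriv, innerSL_apply_apply]
      refine (norm_inner_le_norm _ _).trans ?_
      gcongr
      exact (ContinuousLinearMap.le_opNorm _ _).trans (by gcongr; exact hs'.2)
    rw [hint, hu, sub_zero, abs_one, mul_one, norm_pow, norm_norm, sq] at hb
    rcases (norm_nonneg e).eq_or_lt with h0 | h0
    · rw [← h0]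
      have hε : 0 ≤ ε := by
        obtain ⟨p, hp⟩ := h.exists
        exact (norm_nonneg _).trans hp.2
      positivity
    · exact le_of_mul_le_mul_left hb h0
  have hcl : IsClosed {z | ‖f (z + v) - f z‖ ≤ ε * ‖v‖} := by
    have := hf.continuous
    exact isClosed_le (by fun_prop) continuous_const
  have hall := (Measure.dense_of_ae h3).closure_eq
  rw [hcl.closure_eq] at hall
  have := hall.ge (mem_univ x)
  simpa [hv] using this

/-- In polar coordinates `μ` is a product of the sphere measure with a radial measure, so a null set
of directions sweeps out a null cone. -/
theorem ae_of_ae_toSphere {V : Type*} [NormedAddCommGroup V] [NormedSpace ℝ V]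
    [FiniteDimensional ℝ V] [MeasurableSpace V] [BorelSpace V] [Nontrivial V] (μ : Measure V)
    [μ.IsAddHaarMeasure] {p : V → Prop}
    (h : ∀ᵐ x : Metric.sphere (0 : V) 1 ∂μ.toSphere, p x) :
    ∀ᵐ x ∂μ, p (‖x‖⁻¹ • x) := by
  have h1 : ∀ᵐ q : Metric.sphere (0 : V) 1 × Ioi (0 : ℝ)
      ∂(μ.toSphere.prod (Measure.volumeIoiPow (Module.finrank ℝ V - 1))), p q.1 :=
    Measure.quasiMeasurePreserving_fst.ae h
  have h2 := (μ.measurePreserving_homeomorphUnitSphereProd).quasiMeasurePreserving.ae h1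
  have h3 : ∀ᵐ x : ({0}ᶜ : Set V) ∂(μ.comap (↑)), p (‖(x : V)‖⁻¹ • (x : V)) := by
    filter_upwards [h2] with x hx
    simpa using hx
  have h4 := (ae_restrict_iff_subtype (μ := μ) (measurableSet_singleton (0 : V)).compl
    (p := fun x => p (‖x‖⁻¹ • x))).2 h3
  rwa [Measure.restrict_eq_self_of_ae_mem] at h4
  simp [ae_iff]

section Convergence

variable {n : ℕ} {D : Set (E n)} {L : ℝ}

theorem fderiv_radialExtension_smul {c : ℝ} (hc : 0 < c) (x : E n) :
    fderiv ℝ (radialExtension D) (c • x) = fderiv ℝ (radialExtension D) x := by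
  have h1 : (fun y => radialExtension D (c • y)) = c • radialExtension D := by
    funext y
    rw [Pi.smul_apply, radialExtension, radialExtension, polarRadius_smul D hc, smul_comm]
  have h2 := fderiv_comp_smul (𝕜 := ℝ) (f := radialExtension D) (x := x) c
  rw [h1, fderiv_const_smul_field, Pi.smul_apply] at h2
  exact (smul_right_injective _ hc.ne' h2).symm

/-- The essential supremum of the deviation of the derivative from the identity bounds the
Lipschitz constant of the deviation of the radial extension from the identity. -/
theorem IsRadialBiLip.norm_extension_sub_le (hn : 2 ≤ n) (h : IsRadialBiLip D L) {ε : ℝ}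
    (hε : 0 ≤ ε) (hess : essSup (fun x : Metric.sphere (0 : E n) 1 =>
      ‖fderiv ℝ (radialExtension D) (x : E n) - (1 : ℝ) • ContinuousLinearMap.id ℝ (E n)‖ₑ)
      (volume : Measure (E n)).toSphere ≤ ENNReal.ofReal ε) (x y : E n) :
    ‖(radialExtension D y - y) - (radialExtension D x - x)‖ ≤ ε * ‖y - x‖ := by
  have : Nonempty (Fin n) := ⟨⟨0, by omega⟩⟩
  have hL : 0 ≤ L := zero_le_one.trans h.one_le
  have hlip : LipschitzWith L.toNNReal (radialExtension D) :=
    LipschitzWith.of_dist_le_mul fun x y => by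
      rw [dist_eq_norm, dist_eq_norm, Real.coe_toNNReal _ hL]
      exact h.extension_le y x
  have h1 : ∀ᵐ x : Metric.sphere (0 : E n) 1 ∂(volume : Measure (E n)).toSphere,
      ‖fderiv ℝ (radialExtension D) (x : E n) - (1 : ℝ) • ContinuousLinearMap.id ℝ (E n)‖ ≤ ε := by
    filter_upwards [ENNReal.ae_le_essSup fun x : Metric.sphere (0 : E n) 1 =>
      ‖fderiv ℝ (radialExtension D) (x : E n) - (1 : ℝ) • ContinuousLinearMap.id ℝ (E n)‖ₑ]
      with x hx
    have := hx.trans hess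
    rwa [← ofReal_norm, ENNReal.ofReal_le_ofReal_iff hε] at this
  have h2 := ae_of_ae_toSphere (volume : Measure (E n)) (p := fun x =>
    ‖fderiv ℝ (radialExtension D) x - (1 : ℝ) • ContinuousLinearMap.id ℝ (E n)‖ ≤ ε) h1
  have h0 : ∀ᵐ x : E n, x ≠ 0 := by simp [ae_iff]
  refine norm_sub_le_of_ae_norm_fderiv_le (μ := (volume : Measure (E n)))
    (f := fun y => radialExtension D y - y) (hlip.sub LipschitzWith.id) ?_ x y
  filter_upwards [h2, h0, hlip.ae_differentiableAt (μ := (volume : Measure (E n)))]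
    with x hx hx0 hd
  refine ⟨hd.sub differentiableAt_id, ?_⟩
  rw [fderiv_radialExtension_smul (inv_pos.2 (norm_pos_iff.2 hx0)), one_smul] at hx
  rw [fderiv_fun_sub hd differentiableAt_fun_id, fderiv_fun_id]
  exact hx

/-! ### The sharp tangent angle and the limit of `L_t` -/

theorem acuteAngle_le (u v : E n) : acuteAngle u v ≤ Real.pi / 2 := by
  unfold acuteAngle
  rcases le_total (InnerProductGeometry.angle u v) (Real.pi / 2) with h | h
  · exact (min_le_left _ _).trans h
  · exact (min_le_right _ _).trans (by linarith)

/-- Along the trivial filter the real `liminf` has the default value `0`, which a positive `α` rules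
out. -/
theorem TangentCondition.neBot {α : ℝ} (h : TangentCondition D α) {w : E n}
    (hw : w ∈ frontier D) : (𝓝[frontier D \ {w}] w).NeBot := by
  by_contra hne
  rw [not_neBot] at hne
  have h1 := h.2.2 w hw
  rw [tangentAngle, hne] at h1
  have h2 : liminf (fun z => acuteAngle (z - w) w) ⊥ = 0 := by
    simp [liminf, limsInf]
  linarith [h.1]

theorem TangentCondition.tangentAngle_le {α : ℝ} (h : TangentCondition D α) {w : E n}
    (hw : w ∈ frontier D) : tangentAngle D w ≤ Real.pi / 2 := by
  have := h.neBot hw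
  refine liminf_le_of_frequently_le (Eventually.of_forall fun z => acuteAngle_le _ _).frequently ?_
  refine isBoundedUnder_of ⟨0, fun z => ?_⟩
  exact le_min (InnerProductGeometry.angle_nonneg _ _)
    (sub_nonneg.2 (InnerProductGeometry.angle_le_pi _ _))

theorem le_sharpAngle_of_forall (hne : (frontier D).Nonempty) {β : ℝ}
    (hβ : ∀ w ∈ frontier D, β ≤ tangentAngle D w) : β ≤ sharpAngle D := by
  have : Nonempty (frontier D) := hne.to_subtype
  exact le_ciInf fun w => hβ w w.2

theorem TangentCondition.sharp {α : ℝ} (h : TangentCondition D α)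
    (hne : (frontier D).Nonempty) : TangentCondition D (sharpAngle D) := by
  have hbdd : BddBelow (range fun w : frontier D => tangentAngle D w) :=
    ⟨α, by rintro _ ⟨w, rfl⟩; exact h.2.2 w w.2⟩
  have hle : ∀ w ∈ frontier D, sharpAngle D ≤ tangentAngle D w := fun w hw =>
    ciInf_le hbdd ⟨w, hw⟩
  refine ⟨h.1.trans_le (le_sharpAngle_of_forall hne h.2.2), ?_, hle⟩
  obtain ⟨w, hw⟩ := hne
  exact (hle w hw).trans (h.tangentAngle_le hw)

/-- Let `x`, `y` be the unit vectors under `w`, `z`. Then `z - w` differs from the chord `y - x` by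
at most `ε ‖y - x‖`, and a short chord of the sphere is nearly orthogonal to `x`. -/
theorem le_tangentAngle_of_extension_close (hD : IsStrictlyStarlike D) {α : ℝ}
    (h : TangentCondition D α) {ε : ℝ} (hε : 0 < ε) (hε' : ε ≤ 1 / 4)
    (hclose : ∀ x y, ‖(radialExtension D y - y) - (radialExtension D x - x)‖ ≤ ε * ‖y - x‖)
    {w : E n} (hw : w ∈ frontier D) : Real.arccos (2 * ε) ≤ tangentAngle D w := by
  have := h.neBot hw
  refine le_liminf_of_le (isBoundedUnder_of ⟨Real.pi / 2, fun z => acuteAngle_le _ _⟩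
    |>.isCoboundedUnder_ge) ?_
  have hnear : ∀ᶠ z in 𝓝 w, ‖z - w‖ < ε / 2 := by
    have : Continuous fun z => ‖z - w‖ := by fun_prop
    exact (this.tendsto w).eventually_lt_const (by simpa using hε)
  filter_upwards [hnear.filter_mono nhdsWithin_le_nhds, self_mem_nhdsWithin] with z hz hzM
  obtain ⟨hzM, hzw⟩ := hzM
  have hne : ∀ {w : E n}, w ∈ frontier D → w ≠ 0 := fun hw h =>
    zero_notMem_frontier hD (h ▸ hw)
  have hext : ∀ {w : E n}, w ∈ frontier D → radialExtension D (‖w‖⁻¹ • w) = w := by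
    intro w hw
    have h0 := norm_pos_iff.2 (hne hw)
    rw [radialExtension, polarRadius_smul D (inv_pos.2 h0), polarRadius_of_mem hD hw, smul_smul,
      mul_inv_cancel₀ h0.ne', one_smul]
  have hc := hclose (‖w‖⁻¹ • w) (‖z‖⁻¹ • z)
  rw [hext hw, hext hzM] at hc
  have hx1 := norm_inv_smul_self (hne hw)
  have hy1 := norm_inv_smul_self (hne hzM)
  set x := ‖w‖⁻¹ • w with hx
  set y := ‖z‖⁻¹ • z
  set d := ‖y - x‖ with hd
  have hd0 : 0 ≤ d := norm_nonneg _
  set e := z - y - (w - x) with he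
  have hze : z - w = (y - x) + e := by rw [he]; abel
  have hlow : (1 - ε) * d ≤ ‖z - w‖ := by
    have := norm_sub_le (z - w) e
    rw [hze, add_sub_cancel_right] at this
    rw [hze]
    linarith
  have hdε : d ≤ ε := by nlinarith
  have hzw0 : 0 < ‖z - w‖ := norm_pos_iff.2 (sub_ne_zero.2 hzw)
  have hin1 : inner ℝ (y - x) x = -(d ^ 2 / 2) := by
    have := norm_add_sq_real (y - x) x
    rw [sub_add_cancel, hx1, hy1, ← hd] at this
    linarith
  -- The inner product is at most `d² / 2 + ε d ≤ (3 / 2) ε d`, and `d ≤ (4 / 3) ‖z - w‖` because `ε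
  -- ≤ 1 / 4`.
  have hin2 : |inner ℝ (z - w) x| ≤ 2 * ε * ‖z - w‖ := by
    have h3 : |inner ℝ e x| ≤ ε * d := (abs_real_inner_le_norm e x).trans (by
      rw [hx1, mul_one]; exact hc)
    have h4 : |inner ℝ (z - w) x| ≤ d ^ 2 / 2 + ε * d := by
      rw [hze, inner_add_left, hin1]
      refine (abs_add_le _ _).trans ?_
      rw [abs_neg, abs_of_nonneg (by positivity)]
      linarith
    have h5 : d ^ 2 ≤ ε * d := by rw [sq]; gcongr
    nlinarith
  have hcos : |Real.cos (InnerProductGeometry.angle (z - w) w)| ≤ 2 * ε := by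
    have hxw : InnerProductGeometry.angle (z - w) w = InnerProductGeometry.angle (z - w) x := by
      rw [hx, InnerProductGeometry.angle_smul_right_of_pos _ _
        (inv_pos.2 (norm_pos_iff.2 (hne hw)))]
    rw [hxw, InnerProductGeometry.cos_angle, hx1, mul_one, abs_div, abs_norm,
      div_le_iff₀ hzw0]
    exact hin2
  have hθ0 := InnerProductGeometry.angle_nonneg (z - w) w
  have hθ1 := InnerProductGeometry.angle_le_pi (z - w) w
  obtain ⟨hc1, hc2⟩ := abs_le.1 hcos
  unfold acuteAngle
  set θ := InnerProductGeometry.angle (z - w) w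
  refine le_min ?_ ?_
  · rw [← Real.arccos_cos hθ0 hθ1]
    exact Real.arccos_le_arccos hc2
  · rw [← Real.arccos_cos (x := Real.pi - θ) (by linarith) (by linarith), Real.cos_pi_sub]
    exact Real.arccos_le_arccos (by linarith)

theorem shearNorm_mono {a b : ℝ} (ha : 0 ≤ a) (hab : a ≤ b) : shearNorm a ≤ shearNorm b := by
  unfold shearNorm
  gcongr

theorem cotBound_le_of_arccos_le {ε α : ℝ} (hε : 0 < ε) (hε' : ε ≤ 1 / 4)
    (hα : Real.arccos (2 * ε) ≤ α) (hα' : α ≤ Real.pi / 2) :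
    cotBound α ≤ √((1 - (2 * ε) ^ 2)⁻¹ - 1) := by
  unfold cotBound
  refine Real.sqrt_le_sqrt ?_
  have h0 := Real.arccos_nonneg (2 * ε)
  have h1 : Real.sin (Real.arccos (2 * ε)) ≤ Real.sin α :=
    Real.sin_le_sin_of_le_of_le_pi_div_two (by linarith [Real.pi_pos]) hα' hα
  rw [Real.sin_arccos] at h1
  have h2 : 0 < 1 - (2 * ε) ^ 2 := by nlinarith
  have h3 : 1 - (2 * ε) ^ 2 ≤ Real.sin α ^ 2 := by
    rw [← Real.sq_sqrt h2.le]
    gcongr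
  rw [one_div, inv_pow]
  gcongr

theorem lipConst_sharpAngle_le (hn : 2 ≤ n) (hD : IsStrictlyStarlike D) {α : ℝ}
    (h : TangentCondition D α) {ε : ℝ} (hε : 0 < ε) (hε' : ε ≤ 1 / 4)
    (hclose : ∀ x y, ‖(radialExtension D y - y) - (radialExtension D x - x)‖ ≤ ε * ‖y - x‖) :
    lipConst D (sharpAngle D) ≤
      (1 - ε)⁻¹ * shearNorm √((1 - (2 * ε) ^ 2)⁻¹ - 1) := by
  have hne := frontier_nonempty hD hn
  have hs := h.sharp hne
  have hcot := cotBound_le_of_arccos_le hε hε' (le_sharpAngle_of_forall hne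
    fun w hw => le_tangentAngle_of_extension_close hD h hε hε' hclose hw) hs.2.1
  have hnorm : ∀ w ∈ frontier D, |‖w‖ - 1| ≤ ε := by
    intro w hw
    have hw0 : w ≠ 0 := fun h => zero_notMem_frontier hD (h ▸ hw)
    -- On the boundary the extension sends `w` to `‖w‖ • w`, so comparison with the origin controls
    -- `‖w‖ - 1`.
    have h1 := hclose 0 w
    have h2 : 0 < ‖w‖ := norm_pos_iff.2 hw0
    simp only [radialExtension, smul_zero, sub_zero, polarRadius_of_mem hD hw] at h1
    have e : ‖w‖ • w - w = (‖w‖ - 1) • w := by module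
    rw [e, norm_smul, Real.norm_eq_abs] at h1
    exact le_of_mul_le_mul_right h1 h2
  -- The bound `1 + ε` is weakened to `(1 - ε)⁻¹`, so that both terms of the maximum in `L` share
  -- one majorant.
  have hsup : sSup (norm '' frontier D) ≤ (1 - ε)⁻¹ := by
    refine csSup_le (hne.image _) ?_
    rintro _ ⟨w, hw, rfl⟩
    have h1 := (abs_le.1 (hnorm w hw)).2
    rw [← one_div, le_div_iff₀ (by linarith)]
    nlinarith
  have hinf : 1 - ε ≤ sInf (norm '' frontier D) := by
    refine le_csInf (hne.image _) ?_
    rintro _ ⟨w, hw, rfl⟩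
    linarith [(abs_le.1 (hnorm w hw)).1]
  have hmono := shearNorm_mono (cotBound_nonneg _) hcot
  have hone := one_le_shearNorm (cotBound_nonneg (sharpAngle D))
  have hpos : 0 < 1 - ε := by linarith
  rw [lipConst_eq hs.1 hs.2.1]
  refine max_le ?_ ?_ <;> gcongr

theorem tendsto_lipConst_sharpAngle (hn : 2 ≤ n) {D : ℝ → Set (E n)}
    (hD : ∀ t ∈ Icc (0 : ℝ) 1, IsStrictlyStarlike (D t) ∧ ∃ α : ℝ, TangentCondition (D t) α)
    (hconv : SmoothlyConvergesToSphere D 1) :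
    Tendsto (fun t => lipConst (D t) (sharpAngle (D t))) (𝓝[>] 0) (𝓝 1) := by
  have hev : ∀ᶠ t in 𝓝[>] (0 : ℝ), t ∈ Icc (0 : ℝ) 1 := by
    filter_upwards [Ioc_mem_nhdsGT (zero_lt_one' ℝ)] with t ht using Ioc_subset_Icc_self ht
  have hbil : ∀ t ∈ Icc (0 : ℝ) 1, IsRadialBiLip (D t) (lipConst (D t) (sharpAngle (D t))) := by
    intro t ht
    obtain ⟨h1, α, h2⟩ := hD t ht
    exact (h2.sharp (frontier_nonempty h1 hn)).isRadialBiLip hn h1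
  refine tendsto_order.2 ⟨fun a ha => ?_, fun b hb => ?_⟩
  · filter_upwards [hev] with t ht using ha.trans_le (hbil t ht).one_le
  -- The majorant of `L_t` is continuous at `ε = 0` with value `shearNorm 0 = 1`; a positive `ε`
  -- keeping it below `b` is then fixed before `t`.
  · have hU : ContinuousAt (fun ε : ℝ =>
        (1 - ε)⁻¹ * shearNorm √((1 - (2 * ε) ^ 2)⁻¹ - 1)) 0 := by
      have hs : ContinuousAt (fun ε : ℝ => shearNorm √((1 - (2 * ε) ^ 2)⁻¹ - 1)) 0 := by
        refine continuous_shearNorm.continuousAt.comp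
          (f := fun ε : ℝ => √((1 - (2 * ε) ^ 2)⁻¹ - 1)) ?_
        have : (1 - (2 * (0 : ℝ)) ^ 2) ≠ 0 := by norm_num
        fun_prop (disch := assumption)
      have : (1 - (0 : ℝ)) ≠ 0 := by norm_num
      fun_prop (disch := assumption)
    have hU0 : (1 - (0 : ℝ))⁻¹ * shearNorm √((1 - (2 * (0 : ℝ)) ^ 2)⁻¹ - 1) < b := by
      have h4 : √(4 : ℝ) = 2 := by
        rw [show (4 : ℝ) = 2 ^ 2 by norm_num, Real.sqrt_sq (by norm_num)]
      simpa [shearNorm, h4] using hb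
    obtain ⟨ε, ⟨hεU, hε'⟩, hε⟩ := (((hU.tendsto.eventually_lt_const hU0).and
      (eventually_lt_nhds (by norm_num : (0 : ℝ) < 1 / 4))).filter_mono
        (nhdsWithin_le_nhds (s := Ioi 0)) |>.and self_mem_nhdsWithin).exists
    have hess := (tendsto_order.1 hconv).2 (ENNReal.ofReal ε) (ENNReal.ofReal_pos.2 hε)
    filter_upwards [hev, hess] with t ht hte
    obtain ⟨h1, α, h2⟩ := hD t ht
    exact (lipConst_sharpAngle_le hn h1 h2 hε hε'.le
      ((hbil t ht).norm_extension_sub_le hn (le_of_lt hε) hte.le)).trans_lt hεU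

end Convergence

end QuasiInv

end

/-! ### Assembly of the two statements -/

theorem mainTheorem3 (n : ℕ) (hn : 2 ≤ n) :
    (∀ (D : Set (QuasiInv.E n)) (α : ℝ),
      QuasiInv.IsStrictlyStarlike D → QuasiInv.TangentCondition D α →
      ∀ G : Set (QuasiInv.E n), IsOpen G → IsConnected G → G ≠ Set.univ →
        QuasiInv.QuasiInversionIsBiLipschitz D G (QuasiInv.lipConst D α ^ 8)) ∧
    (∀ D : ℝ → Set (QuasiInv.E n),
      (∀ t ∈ Set.Icc (0 : ℝ) 1, QuasiInv.IsStrictlyStarlike (D t) ∧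
        ∃ α : ℝ, QuasiInv.TangentCondition (D t) α) →
      QuasiInv.SmoothlyConvergesToSphere D 1 →
      Filter.Tendsto (fun t => QuasiInv.lipConst (D t) (QuasiInv.sharpAngle (D t)))
        (nhdsWithin 0 (Set.Ioi 0)) (nhds 1) ∧
      ∀ t ∈ Set.Icc (0 : ℝ) 1, ∀ G : Set (QuasiInv.E n),
        IsOpen G → IsConnected G → G ≠ Set.univ →
          QuasiInv.QuasiInversionIsBiLipschitz (D t) G
            (QuasiInv.lipConst (D t) (QuasiInv.sharpAngle (D t)) ^ 8)) := by
  have key : ∀ (D : Set (QuasiInv.E n)) (α : ℝ), QuasiInv.IsStrictlyStarlike D →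
      QuasiInv.TangentCondition D α → ∀ G : Set (QuasiInv.E n),
        QuasiInv.QuasiInversionIsBiLipschitz D G (QuasiInv.lipConst D α ^ 8) :=
    fun D α hD hα G => (hα.isRadialBiLip hn hD).quasiInversionIsBiLipschitz G
  refine ⟨fun D α hD hα G _ _ _ => key D α hD hα G, fun D hD hconv =>
    ⟨QuasiInv.tendsto_lipConst_sharpAngle hn hD hconv, fun t ht G _ _ _ => ?_⟩⟩
  obtain ⟨h1, α, h2⟩ := hD t ht
  exact key _ _ h1 (h2.sharp (QuasiInv.frontier_nonempty h1 hn)) G
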